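/- Let $\nu(dx)=\frac{dx}{2\cosh(\pi x/2)}$ on $\mathbb R$, and let $P_k$, $k\ge 0$, be the Meixner–Pollaczek polynomials, defined by the Taylor expansion $$\frac{e^{x\arctan s}}{\sqrt{1+s^2}}=\sum_{k\ge 0}P_k(x)s^k\qquad(|s|<1).$$ Let $f\in L^2(\nu)$ be (real- or complex-valued and) holomorphic in a neighbourhood of the closed strip $\{|\operatorname{Im}z|\le 1\}$, and suppose that for some $\alpha<\pi/4$ one has $|f(R+iv)|=O(e^{\alpha|R|})$ as $|R|\to\infty$, uniformly in $|v|\le 1$. Put $f_k=\int_{\mathbb R} f\,P_k\,d\nu$. Let $\varphi:(0,1)\to[0,\infty)$ be measurable, extended by $0$ outside $(0,1)$, and put $$\Gamma_\varphi(k)=2k\int_0^1(1-\varepsilon)^{2k}\varphi(\varepsilon)\,d\varepsilon,\qquad \Phi(t)=\int_0^t\varphi(\varepsilon)\,d\varepsilon ,$$ both with values in $[0,\infty]$. For real $u,x,v$ put $$\Delta_f(x)=f(x+i)-f(x-i),\qquad K_u(x)=\frac{x\,e^{ux}}{\sinh(\pi x/2)},\qquad \widehat g(v)=\int_{\mathbb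 R}g(x)e^{ixv}\,dx .$$ Then $K_u\Delta_f$ is integrable on $\mathbb R$ for every $|u|\le\pi/4$, and, in $[0,\infty]$ with the convention $0\cdot\infty=0$, $$\sum_{k=1}^\infty\Gamma_\varphi(k)|f_k|^2\;\le\;\frac1{8\pi}\int_{-\pi/4}^{\pi/4}\int_{\mathbb R}\bigl|\widehat{K_u\Delta_f}(v)\bigr|^2\,\Phi\bigl((\pi-4|u|)e^{-2|v|}\bigr)\,dv\,du$$ and $$\sum_{k=1}^\infty\Gamma_\varphi(k)|f_k|^2\;\ge\;\frac1{8\pi}\int_{-\pi/4}^{\pi/4}\int_{\mathbb R}\bigl|\widehat{K_u\Delta_f}(v)\bigr|^2\,\Phi\Bigl(\tfrac1{2\pi}(\pi-4|u|)e^{-2|v|}\Bigr)\,dv\,du .$$ -/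

import Mathlib

open MeasureTheory Set

namespace MeixnerPollaczek

noncomputable section

/-- The probability measure `ν(dx) = dx / (2 cosh (π x / 2))` on the real line. -/
def nu : Measure ℝ :=
  volume.withDensity fun x => ENNReal.ofReal (1 / (2 * Real.cosh (Real.pi * x / 2)))

/-- The generating function `G(x, s) = exp (x arctan s) / (1 + s²) ^ (1/2)`, with principal
branches; it is holomorphic in `s` for `|s| < 1`. -/
def genFun (x s : ℂ) : ℂ :=
  Complex.exp (x * Complex.arctan s) / (1 + s ^ 2) ^ (1 / 2 : ℂ)

/-- The `k`-th Meixner-Pollaczek polynomial `P_k`: the coefficient of `s ^ k` in the Taylor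
expansion `G(x, s) = ∑ P_k(x) s ^ k` around `s = 0`. -/
def mpPoly (k : ℕ) (x : ℂ) : ℂ :=
  iteratedDeriv k (fun s : ℂ => genFun x s) 0 / (Nat.factorial k : ℂ)

/-- The coefficient `f_k = ⟨f, P_k⟩` in `L²(ν)`. No conjugate is written, because `P_k` takes
real values on the real line. -/
def coeff (f : ℂ → ℂ) (k : ℕ) : ℂ :=
  ∫ x : ℝ, f (x : ℂ) * mpPoly k (x : ℂ) ∂nu

/-- The closed horizontal strip `|Im z| ≤ 1`. -/
def strip : Set ℂ := {z : ℂ | |z.im| ≤ 1}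

/-- The class `𝓕₁`: functions in `L²(ν)`, holomorphic in a neighbourhood of the strip
`|Im z| ≤ 1`, with `|f (R + i v)| = O (exp (α |R|))` as `|R| → ∞`, uniformly in `|v| ≤ 1`,
for some `α < π / 4`. -/
structure ClassF1 (f : ℂ → ℂ) : Prop where
  memLp : MemLp (fun x : ℝ => f (x : ℂ)) 2 nu
  holomorphic : ∃ U : Set ℂ, IsOpen U ∧ strip ⊆ U ∧ DifferentiableOn ℂ f U
  growth : ∃ α : ℝ, α < Real.pi / 4 ∧ ∃ C R₀ : ℝ, ∀ R v : ℝ, R₀ ≤ |R| → |v| ≤ 1 →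
    ‖f ((R : ℂ) + (v : ℂ) * Complex.I)‖ ≤ C * Real.exp (α * |R|)

/-- `Γ_φ(k) = 2k ∫₀¹ (1 - ε)^(2k) φ(ε) dε`, as an element of `[0, ∞]`. -/
def Gam (φ : ℝ → ℝ) (k : ℕ) : ENNReal :=
  2 * (k : ENNReal) * ∫⁻ ε in Ioo (0 : ℝ) 1, ENNReal.ofReal ((1 - ε) ^ (2 * k) * φ ε)

/-- `Φ(t) = ∫₀ᵗ φ(ε) dε`, as an element of `[0, ∞]`, where `φ` is taken to be `0` outside
`(0, 1)`. -/
def Phi (φ : ℝ → ℝ) (t : ℝ) : ENNReal :=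
  ∫⁻ ε in Ioo (0 : ℝ) t, (Ioo (0 : ℝ) 1).indicator (fun ε => ENNReal.ofReal (φ ε)) ε

/-- `Δ_f(x) = f(x + i) - f(x - i)`. -/
def Del (f : ℂ → ℂ) (x : ℝ) : ℂ := f ((x : ℂ) + Complex.I) - f ((x : ℂ) - Complex.I)

/-- `K_u(x) = x exp (u x) / sinh (π x / 2)`. It is used under integrals in `x` only, so the
value at the removable singularity `x = 0` is immaterial. -/
def Ker (u x : ℝ) : ℝ := x * Real.exp (u * x) / Real.sinh (Real.pi * x / 2)

/-- The Fourier transform `ĝ(v) = ∫ g(x) exp (i x v) dx`. -/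
def fourierHat (g : ℝ → ℂ) (v : ℝ) : ℂ :=
  ∫ x : ℝ, g x * Complex.exp (Complex.I * (x : ℂ) * (v : ℂ))

/-- The quantity
`(1 / 8π) ∫_{|u| ≤ π/4} ∫_ℝ |(K_u Δ_f)^ (v)|² Φ(c (π - 4|u|) exp (-2|v|)) dv du`,
in `[0, ∞]`. -/
def energy (φ : ℝ → ℝ) (f : ℂ → ℂ) (c : ℝ) : ENNReal :=
  ENNReal.ofReal (1 / (8 * Real.pi)) *
    ∫⁻ u in Icc (-(Real.pi / 4)) (Real.pi / 4), ∫⁻ v : ℝ,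
      ‖fourierHat (fun x => (Ker u x : ℂ) * Del f x) v‖ₑ ^ 2 *
        Phi φ (c * (Real.pi - 4 * |u|) * Real.exp (-2 * |v|))

end

end MeixnerPollaczek

namespace MeixnerPollaczek

/-! Let F(s) = ∑ f_k s^k = ∫ f(x) G(x, s) ν(dx) on the unit disc. Polar coordinates, Parseval on
circles and Fubini in the weight turn the coefficient sum into a weighted Dirichlet integral, (2/π)
∫ |F'(s)|² Φ(1 - |s|) over |s| < 1 (`tsum_Gam_mul_sq`). Since s = tan θ maps the strip |Re θ| < π/4
conformally onto the disc, this is (2/π) times the integral of |d/dθ F(tan θ)|² Φ(1 - |tan θ|) over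
the strip.

In this variable G(x, tan θ) = e^{xθ} cos θ, so d/dθ F(tan θ) = ∫ f(x) e^{xθ} (x cos θ - sin θ)
ν(dx). On the other side, shifting the contours ℝ ± i to ℝ in the two halves of the Fourier
transform of K_u Δ_f turns x / sinh(πx/2) into ±i (x ∓ i) / cosh(πx/2), and the transform at v is 4i
times that same derivative at θ = u + iv (`fourierHat_eq_deriv`).

The coefficient sum is therefore equal to the strip integral with weight Φ(1 - |tan θ|)
(`tsum_Gam_eq_lintegral`). As Φ is monotone, both inequalities reduce to pointwise bounds for 1 -
|tan θ| (`one_sub_norm_tan_le`, `le_one_sub_norm_tan`). -/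

/-! ### The tangent as a conformal map of the strip onto the disc, and the size of 1 - |tan θ| -/

lemma norm_cos_sq (z : ℂ) :
    ‖Complex.cos z‖ ^ 2 = (Real.cosh (2 * z.im) + Real.cos (2 * z.re)) / 2 := by
  rw [← Complex.normSq_eq_norm_sq, Complex.cos_eq, ← Complex.ofReal_cos, ← Complex.ofReal_cosh,
    ← Complex.ofReal_sin, ← Complex.ofReal_sinh, Real.cosh_two_mul, Real.cos_two_mul]
  have h1 := Real.sin_sq_add_cos_sq z.re
  have h2 := Real.cosh_sq z.im
  simp [Complex.normSq_apply, Complex.cos_ofReal_re, Complex.sin_ofReal_re,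
    Complex.sinh_ofReal_re]
  linear_combination (Real.sinh z.im ^ 2) * h1 + (Real.cos z.re ^ 2 - 1 / 2) * h2

lemma norm_sin_sq (z : ℂ) :
    ‖Complex.sin z‖ ^ 2 = (Real.cosh (2 * z.im) - Real.cos (2 * z.re)) / 2 := by
  rw [← Complex.normSq_eq_norm_sq, Complex.sin_eq, ← Complex.ofReal_cos, ← Complex.ofReal_cosh,
    ← Complex.ofReal_sin, ← Complex.ofReal_sinh, Real.cosh_two_mul, Real.cos_two_mul]
  have h1 := Real.sin_sq_add_cos_sq z.re
  have h2 := Real.cosh_sq z.im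
  simp [Complex.normSq_apply, Complex.cos_ofReal_re, Complex.sin_ofReal_re,
    Complex.sinh_ofReal_re]
  linear_combination (Real.cosh z.im ^ 2) * h1 + (1 / 2 - Real.cos z.re ^ 2) * h2

lemma norm_tan_sq (z : ℂ) :
    ‖Complex.tan z‖ ^ 2 = (Real.cosh (2 * z.im) - Real.cos (2 * z.re)) /
      (Real.cosh (2 * z.im) + Real.cos (2 * z.re)) := by
  rw [Complex.tan_eq_sin_div_cos, norm_div, div_pow, norm_cos_sq, norm_sin_sq,
    div_div_div_cancel_right₀ two_ne_zero]

/-- The open vertical strip `|Re θ| < π / 4`, which `tan` maps bijectively to the unit disc. -/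
def vstrip : Set ℂ := {z : ℂ | |z.re| < Real.pi / 4}

lemma isOpen_vstrip : IsOpen vstrip :=
  isOpen_lt (by fun_prop) continuous_const

lemma cos_two_re_pos {z : ℂ} (hz : z ∈ vstrip) : 0 < Real.cos (2 * z.re) := by
  have := abs_lt.1 (show |z.re| < Real.pi / 4 from hz)
  exact Real.cos_pos_of_mem_Ioo ⟨by linarith, by linarith⟩

lemma cos_re_pos {z : ℂ} (hz : z ∈ vstrip) : 0 < (Complex.cos z).re := by
  have := abs_lt.1 (show |z.re| < Real.pi / 4 from hz)
  have h : 0 < Real.cos z.re := Real.cos_pos_of_mem_Ioo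
    ⟨by linarith [Real.pi_pos], by linarith [Real.pi_pos]⟩
  rw [Complex.cos_eq, ← Complex.ofReal_cos, ← Complex.ofReal_cosh,
    ← Complex.ofReal_sin, ← Complex.ofReal_sinh]
  simpa [Complex.cos_ofReal_re] using mul_pos h (Real.cosh_pos _)

lemma cos_ne_zero {z : ℂ} (hz : z ∈ vstrip) : Complex.cos z ≠ 0 := fun h => by
  simpa [h] using cos_re_pos hz

lemma norm_tan_lt_one {z : ℂ} (hz : z ∈ vstrip) : ‖Complex.tan z‖ < 1 := by
  have h1 := cos_two_re_pos hz
  have h2 := Real.one_le_cosh (2 * z.im)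
  refine lt_of_pow_lt_pow_left₀ 2 zero_le_one ?_
  rw [norm_tan_sq, one_pow, div_lt_one (by linarith)]
  linarith

/-- Re (arctan s) is half the argument of the Cayley transform (1 + is) / (1 - is), which sends the
unit disc into the right half-plane. -/
lemma arctan_mem_vstrip {s : ℂ} (hs : ‖s‖ < 1) : Complex.arctan s ∈ vstrip := by
  have hlog : (Complex.log ((1 + s * Complex.I) / (1 - s * Complex.I))).im =
      ((1 + s * Complex.I) / (1 - s * Complex.I)).arg := Complex.log_im _
  have hne : (1 - s * Complex.I) ≠ 0 := by
    intro h
    have : ‖s * Complex.I‖ = 1 := by rw [← sub_eq_zero.1 h]; simp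
    simp at this; linarith
  have hre : (Complex.arctan s).re =
      ((1 + s * Complex.I) / (1 - s * Complex.I)).arg / 2 := by
    rw [Complex.arctan, ← hlog]
    simp [Complex.mul_re]
    ring
  have hpos : 0 < ((1 + s * Complex.I) / (1 - s * Complex.I)).re := by
    have h1 : Complex.normSq s < 1 := by
      rw [Complex.normSq_eq_norm_sq]; nlinarith [norm_nonneg s]
    have h2 := Complex.normSq_pos.2 hne
    rw [Complex.div_re, ← add_div]
    refine div_pos ?_ h2
    rw [Complex.normSq_apply] at h1
    simp
    nlinarith
  have := abs_lt.1 (Complex.abs_arg_lt_pi_div_two_iff.2 (Or.inl hpos))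
  show |(Complex.arctan s).re| < _
  rw [hre, abs_lt]
  constructor <;> linarith

lemma arctan_tan_of_mem {z : ℂ} (hz : z ∈ vstrip) : Complex.arctan (Complex.tan z) = z := by
  have := abs_lt.1 (show |z.re| < Real.pi / 4 from hz)
  have hpi := Real.pi_pos
  refine Complex.arctan_tan ?_ (by linarith) (by linarith)
  intro h
  have : z.re = Real.pi / 2 := by rw [h]; simp
  linarith

lemma tan_arctan_of_norm_lt_one {s : ℂ} (hs : ‖s‖ < 1) :
    Complex.tan (Complex.arctan s) = s := by
  refine Complex.tan_arctan ?_ ?_ <;> rintro rfl <;> simp at hs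

lemma tan_image_vstrip : Complex.tan '' vstrip = Metric.ball 0 1 := by
  ext s
  rw [mem_ball_zero_iff]
  constructor
  · rintro ⟨z, hz, rfl⟩
    exact norm_tan_lt_one hz
  · exact fun hs => ⟨_, arctan_mem_vstrip hs, tan_arctan_of_norm_lt_one hs⟩

lemma injOn_tan_vstrip : InjOn Complex.tan vstrip := fun z hz w hw h => by
  rw [← arctan_tan_of_mem hz, h, arctan_tan_of_mem hw]

/-- Change of variables `s = tan θ` between the strip `|Re θ| < π / 4` and the unit disc. -/
lemma lintegral_ball_eq_lintegral_vstrip (g : ℂ → ENNReal) :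
    ∫⁻ s in Metric.ball (0 : ℂ) 1, g s =
      ∫⁻ z in vstrip, ‖1 / Complex.cos z ^ 2‖ₑ ^ 2 * g (Complex.tan z) := by
  have hd : ∀ z ∈ vstrip, HasFDerivWithinAt Complex.tan
      ((ContinuousLinearMap.toSpanSingleton ℂ (1 / Complex.cos z ^ 2)).restrictScalars ℝ)
      vstrip z := fun z hz =>
    ((Complex.hasDerivAt_tan (cos_ne_zero hz)).hasFDerivAt.restrictScalars ℝ).hasFDerivWithinAt
  rw [← tan_image_vstrip, lintegral_image_eq_lintegral_abs_det_fderiv_mul volume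
    isOpen_vstrip.measurableSet hd injOn_tan_vstrip]
  refine setLIntegral_congr_fun isOpen_vstrip.measurableSet fun z _ => ?_
  congr 1
  -- Multiplication by w has real determinant |w|².
  have : ((ContinuousLinearMap.toSpanSingleton ℂ
      (1 / Complex.cos z ^ 2)).restrictScalars ℝ).det = ‖1 / Complex.cos z ^ 2‖ ^ 2 := by
    rw [← Complex.normSq_eq_norm_sq]
    simp [ContinuousLinearMap.det, LinearMap.det_restrictScalars, Algebra.norm_complex_apply]
  rw [this, abs_of_nonneg (by positivity), ENNReal.ofReal_pow (norm_nonneg _), ofReal_norm]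

/-- The value of `1 - |tan θ|` in terms of `cos (2 Re θ)` and `cosh (2 Im θ)`. -/
lemma one_sub_norm_tan {z : ℂ} (hz : z ∈ vstrip) :
    1 - ‖Complex.tan z‖ = 2 * Real.cos (2 * z.re) / (Real.cos (2 * z.re) + Real.cosh (2 * z.im)
      + √(Real.cosh (2 * z.im) ^ 2 - Real.cos (2 * z.re) ^ 2)) := by
  have h1 := cos_two_re_pos hz
  have h2 := Real.one_le_cosh (2 * z.im)
  have h3 := Real.cos_le_one (2 * z.re)
  have ht := norm_tan_sq z
  generalize Real.cos (2 * z.re) = a at *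
  generalize Real.cosh (2 * z.im) = b at *
  have hn := norm_nonneg (Complex.tan z)
  generalize ‖Complex.tan z‖ = t at *
  -- With t² = (b - a)/(b + a) the denominator becomes (1 + t)(a + b), and (1 - t²)(a + b) = 2a.
  have hs : √(b ^ 2 - a ^ 2) = t * (a + b) := by
    rw [Real.sqrt_eq_iff_mul_self_eq (by nlinarith) (by positivity)]
    field_simp at ht
    linear_combination -(b + a) * ht
  rw [hs, eq_div_iff (by positivity)]
  have h4 : t ^ 2 * (b + a) = b - a := by rw [ht]; field_simp
  linear_combination -h4

lemma exp_two_abs (v : ℝ) :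
    Real.exp (2 * |v|) = Real.cosh (2 * v) + √(Real.cosh (2 * v) ^ 2 - 1) := by
  have h : Real.cosh (2 * v) ^ 2 - 1 = Real.sinh |2 * v| ^ 2 := by
    rw [← Real.cosh_abs, Real.cosh_sq]; ring
  rw [h, Real.sqrt_sq (Real.sinh_nonneg_iff.2 (abs_nonneg _)), ← Real.cosh_abs,
    Real.cosh_add_sinh, abs_mul, abs_two]

lemma cos_two_re_eq_sin (u : ℝ) : Real.cos (2 * u) = Real.sin (Real.pi / 2 - 2 * |u|) := by
  rw [Real.sin_pi_div_two_sub, ← Real.cos_abs, abs_mul, abs_two]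

/-- In the exact formula the numerator is controlled by sin y ≤ y at y = π/2 - 2|Re z|. The
denominator only decreases when its first term is dropped and the cosine under the root is replaced
by 1, which leaves e^{2|Im z|}. -/
lemma one_sub_norm_tan_le {z : ℂ} (hz : z ∈ vstrip) :
    1 - ‖Complex.tan z‖ ≤ (Real.pi - 4 * |z.re|) * Real.exp (-2 * |z.im|) := by
  have h1 := cos_two_re_pos hz
  have h2 := Real.one_le_cosh (2 * z.im)
  have h3 := Real.cos_le_one (2 * z.re)
  have hw : |z.re| < Real.pi / 4 := hz
  have h4 : Real.cos (2 * z.re) ≤ Real.pi / 2 - 2 * |z.re| := by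
    rw [cos_two_re_eq_sin]
    exact Real.sin_le (by linarith)
  rw [one_sub_norm_tan hz, neg_mul, Real.exp_neg, ← div_eq_mul_inv, exp_two_abs]
  gcongr ?_ / ?_
  · linarith
  · linarith
  · have : √(Real.cosh (2 * z.im) ^ 2 - 1) ≤
        √(Real.cosh (2 * z.im) ^ 2 - Real.cos (2 * z.re) ^ 2) :=
      Real.sqrt_le_sqrt (by nlinarith)
    linarith

/-- Jordan's inequality sin y ≥ 2y/π bounds the numerator from below. Each of the three terms of the
denominator is at most e^{2|Im z|}; the cruder bound 4 e^{2|Im z|} for their sum gives the constant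
1/(2π). -/
lemma le_one_sub_norm_tan {z : ℂ} (hz : z ∈ vstrip) :
    1 / (2 * Real.pi) * (Real.pi - 4 * |z.re|) * Real.exp (-2 * |z.im|) ≤
      1 - ‖Complex.tan z‖ := by
  have h1 := cos_two_re_pos hz
  have h2 := Real.one_le_cosh (2 * z.im)
  have h3 := Real.cos_le_one (2 * z.re)
  have hw : |z.re| < Real.pi / 4 := hz
  have hpi := Real.pi_pos
  have h4 : 2 / Real.pi * (Real.pi / 2 - 2 * |z.re|) ≤ Real.cos (2 * z.re) := by
    rw [cos_two_re_eq_sin]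
    exact Real.mul_le_sin (by linarith) (by linarith [abs_nonneg z.re])
  have hE : 1 ≤ Real.exp (2 * |z.im|) := Real.one_le_exp (by positivity)
  have h5 : Real.cosh (2 * z.im) ≤ Real.exp (2 * |z.im|) := by
    rw [exp_two_abs]; linarith [Real.sqrt_nonneg (Real.cosh (2 * z.im) ^ 2 - 1)]
  have h6 : √(Real.cosh (2 * z.im) ^ 2 - Real.cos (2 * z.re) ^ 2) ≤ Real.exp (2 * |z.im|) := by
    refine Real.sqrt_le_iff.2 ⟨by positivity, ?_⟩
    nlinarith
  rw [one_sub_norm_tan hz, neg_mul, Real.exp_neg, ← div_eq_mul_inv]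
  have h7 : 1 / (2 * Real.pi) * (Real.pi - 4 * |z.re|) =
      (2 / Real.pi * (Real.pi / 2 - 2 * |z.re|)) / 2 := by field_simp; ring
  rw [h7, div_le_div_iff₀ (by positivity) (by positivity)]
  generalize 2 / Real.pi * (Real.pi / 2 - 2 * |z.re|) = w at *
  have h8 : Real.cos (2 * z.re) + Real.cosh (2 * z.im) +
      √(Real.cosh (2 * z.im) ^ 2 - Real.cos (2 * z.re) ^ 2) ≤ 4 * Real.exp (2 * |z.im|) := by
    linarith
  have h9 : 0 ≤ Real.cos (2 * z.re) + Real.cosh (2 * z.im) +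
      √(Real.cosh (2 * z.im) ^ 2 - Real.cos (2 * z.re) ^ 2) := by positivity
  calc _ ≤ Real.cos (2 * z.re) / 2 * _ := by gcongr
    _ ≤ Real.cos (2 * z.re) / 2 * (4 * Real.exp (2 * |z.im|)) := by gcongr
    _ = _ := by ring

/-! ### Parseval's identity and weighted Dirichlet integrals on the disc -/

lemma integral_exp_int_mul (n : ℤ) :
    ∫ t in Ioc (-Real.pi) Real.pi, Complex.exp (Complex.I * n * (t : ℂ)) =
      if n = 0 then 2 * (Real.pi : ℂ) else 0 := by
  rw [← intervalIntegral.integral_of_le (by linarith [Real.pi_pos])]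
  split_ifs with h
  · subst h
    simp; ring
  · rw [integral_exp_mul_complex (by simp [h]), div_eq_zero_iff]
    left
    rw [sub_eq_zero, Complex.exp_eq_exp_iff_exists_int]
    exact ⟨n, by push_cast; ring⟩

/-- Parseval's identity for an absolutely convergent Fourier series with nonnegative
frequencies. -/
lemma lintegral_sq_tsum_exp {a : ℕ → ℂ} (ha : Summable fun k => ‖a k‖) :
    ∫⁻ t in Ioo (-Real.pi) Real.pi, ‖∑' k, a k * Complex.exp (Complex.I * k * (t : ℂ))‖ₑ ^ 2 =
      ENNReal.ofReal (2 * Real.pi) * ∑' k, ‖a k‖ₑ ^ 2 := by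
  have hpi := Real.pi_pos
  have hne : ∀ (k : ℕ) (t : ℝ), ‖Complex.exp (Complex.I * k * (t : ℂ))‖ = 1 := fun k t => by
    rw [show Complex.I * k * (t : ℂ) = ((k * t : ℝ) : ℂ) * Complex.I by push_cast; ring,
      Complex.norm_exp_ofReal_mul_I]
  set A : ℝ → ℂ := fun t => ∑' k, a k * Complex.exp (Complex.I * k * (t : ℂ)) with hA
  have hAc : Continuous A := continuous_tsum (fun k => by fun_prop) ha
    fun k t => by rw [norm_mul, hne, mul_one]
  have hfin : volume.real (Ioc (-Real.pi) Real.pi) = 2 * Real.pi := by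
    rw [Real.volume_real_Ioc_of_le (by linarith)]; ring
  have hint : ∀ {g : ℝ → ℂ}, Continuous g → IntegrableOn g (Ioc (-Real.pi) Real.pi) := fun hg =>
    hg.integrableOn_Ioc
  have hcoef : ∀ n : ℕ, ∫ t in Ioc (-Real.pi) Real.pi,
      A t * Complex.exp (-(Complex.I * n * (t : ℂ))) = 2 * Real.pi * a n := fun n => by
    have hs := hasSum_integral_of_summable_integral_norm
      (μ := volume.restrict (Ioc (-Real.pi) Real.pi))
      (F := fun k t => a k * Complex.exp (Complex.I * ((k - n : ℤ) : ℂ) * (t : ℂ)))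
      (fun k => hint (by fun_prop)) (by
        have : ∀ (k : ℕ) (t : ℝ),
            ‖a k * Complex.exp (Complex.I * ((k - n : ℤ) : ℂ) * (t : ℂ))‖ = ‖a k‖ := fun k t => by
          rw [norm_mul, show Complex.I * ((k - n : ℤ) : ℂ) * (t : ℂ) =
            (((k - n : ℤ) * t : ℝ) : ℂ) * Complex.I by push_cast; ring,
            Complex.norm_exp_ofReal_mul_I, mul_one]
        simp only [this, integral_const, smul_eq_mul]
        exact ha.mul_left _)
    have h1 : ∀ t : ℝ, ∑' k : ℕ, a k * Complex.exp (Complex.I * ((k - n : ℤ) : ℂ) * (t : ℂ)) =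
        A t * Complex.exp (-(Complex.I * n * (t : ℂ))) := fun t => by
      rw [hA, ← tsum_mul_right]
      congr 1 with k
      rw [mul_assoc (a k), ← Complex.exp_add]
      congr 2
      push_cast
      ring
    simp only [h1] at hs
    have e0 : ∀ k : ℕ, ∫ t in Ioc (-Real.pi) Real.pi,
        a k * Complex.exp (Complex.I * ((k - n : ℤ) : ℂ) * (t : ℂ)) =
        if k = n then 2 * Real.pi * a n else 0 := fun k => by
      rw [integral_const_mul, integral_exp_int_mul]
      by_cases hk : k = n
      · subst hk; simp; ring
      · have : ((k : ℤ) - n) ≠ 0 := by omega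
        simp [hk, this]
    simp only [e0] at hs
    exact hs.unique (hasSum_ite_eq n _)
  -- Only the conjugate factor of A · conj A is expanded; the n-th term then contains the Fourier
  -- coefficient already found in `hcoef`.
  have hsum : HasSum (fun n => ((2 * Real.pi * ‖a n‖ ^ 2 : ℝ) : ℂ))
      ((∫ t in Ioc (-Real.pi) Real.pi, ‖A t‖ ^ 2 : ℝ) : ℂ) := by
    have hbd : ∀ t, ‖A t‖ ≤ ∑' k, ‖a k‖ := fun t => by
      refine tsum_of_norm_bounded ha.hasSum fun k => ?_
      rw [norm_mul, hne, mul_one]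
    have hs := hasSum_integral_of_summable_integral_norm
      (μ := volume.restrict (Ioc (-Real.pi) Real.pi))
      (F := fun n t => (starRingEnd ℂ) (a n) *
        (A t * Complex.exp (-(Complex.I * n * (t : ℂ)))))
      (fun k => hint (by fun_prop)) (by
        refine Summable.of_nonneg_of_le (fun n => by positivity) (fun n => ?_)
          (ha.mul_left ((∑' k, ‖a k‖) * (2 * Real.pi)))
        refine (integral_mono_of_nonneg (Filter.Eventually.of_forall fun t => by positivity)
          (integrable_const (‖a n‖ * ∑' k, ‖a k‖))
          (Filter.Eventually.of_forall fun t => ?_)).trans ?_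
        · simp only [norm_mul, RCLike.norm_conj, Complex.exp_neg, norm_inv, hne, inv_one, mul_one]
          gcongr
          exact hbd t
        · simp [hfin]
          linarith)
    simp only [integral_const_mul, hcoef] at hs
    have e1 : ∀ n, ((2 * Real.pi * ‖a n‖ ^ 2 : ℝ) : ℂ) =
        (starRingEnd ℂ) (a n) * (2 * Real.pi * a n) := fun n => by
      rw [show (starRingEnd ℂ) (a n) * (2 * Real.pi * a n) =
        2 * Real.pi * (a n * (starRingEnd ℂ) (a n)) by ring, Complex.mul_conj']
      push_cast; rfl
    have e2 : ((∫ t in Ioc (-Real.pi) Real.pi, ‖A t‖ ^ 2 : ℝ) : ℂ) =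
        ∫ t in Ioc (-Real.pi) Real.pi, ∑' n : ℕ, (starRingEnd ℂ) (a n) *
          (A t * Complex.exp (-(Complex.I * n * (t : ℂ)))) := by
      rw [← integral_complex_ofReal]
      congr 1 with t
      have : ∀ n : ℕ, (starRingEnd ℂ) (a n) * (A t * Complex.exp (-(Complex.I * n * (t : ℂ)))) =
          A t * (starRingEnd ℂ) (a n * Complex.exp (Complex.I * n * (t : ℂ))) := fun n => by
        rw [map_mul, ← Complex.exp_conj]
        simp
        ring
      simp only [this]
      rw [tsum_mul_left, ← Complex.conj_tsum]
      change _ = A t * (starRingEnd ℂ) (A t)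
      rw [Complex.mul_conj']
      push_cast; rfl
    rw [e2]
    simpa only [e1] using hs
  have hsum' := Complex.hasSum_ofReal.1 hsum
  have hlin : ∫⁻ t in Ioo (-Real.pi) Real.pi, ‖A t‖ₑ ^ 2 =
      ENNReal.ofReal (∫ t in Ioc (-Real.pi) Real.pi, ‖A t‖ ^ 2) := by
    rw [setLIntegral_congr Ioo_ae_eq_Ioc, ofReal_integral_eq_lintegral_ofReal]
    · refine lintegral_congr fun t => ?_
      rw [ENNReal.ofReal_pow (norm_nonneg _), ofReal_norm]
    · exact (hAc.norm.pow 2).integrableOn_Ioc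
    · exact Filter.Eventually.of_forall fun t => by positivity
  rw [hlin, ← hsum'.tsum_eq, ENNReal.ofReal_tsum_of_nonneg (fun n => by positivity) hsum'.summable,
    ← ENNReal.tsum_mul_left]
  refine tsum_congr fun n => ?_
  rw [ENNReal.ofReal_mul (by positivity), ENNReal.ofReal_pow (norm_nonneg _), ofReal_norm]

/-- The weighted area integral of the square of a power series over the unit disc. -/
lemma lintegral_ball_sq_powerSeries {c : ℕ → ℂ} {D : ℂ → ℂ} {w : ℝ → ENNReal} (hw : Measurable w)
    (hD : ∀ s : ℂ, ‖s‖ < 1 → HasSum (fun k => c k * s ^ k) (D s))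
    (hDc : ContinuousOn D (Metric.ball 0 1)) :
    ∫⁻ s in Metric.ball (0 : ℂ) 1, ‖D s‖ₑ ^ 2 * w ‖s‖ =
      ENNReal.ofReal (2 * Real.pi) *
        ∑' k, ‖c k‖ₑ ^ 2 * ∫⁻ r in Ioo (0 : ℝ) 1, ENNReal.ofReal (r ^ (2 * k + 1)) * w r := by
  classical
  -- D is controlled only inside the disc, so its extension by zero supplies measurability on the
  -- whole plane.
  have hDm : Measurable ((Metric.ball (0 : ℂ) 1).indicator D) := by
    rw [← piecewise_eq_indicator]
    exact hDc.measurable_piecewise continuousOn_const Metric.isOpen_ball.measurableSet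
  have hf : Measurable fun s : ℂ =>
      ‖(Metric.ball (0 : ℂ) 1).indicator D s‖ₑ ^ 2 * w ‖s‖ := by fun_prop
  have hpol : ∀ p : ℝ × ℝ, Complex.polarCoord.symm p = p.1 * Complex.exp (Complex.I * p.2) :=
    fun p => by
      rw [Complex.polarCoord_symm_apply, mul_comm Complex.I, Complex.exp_mul_I]
      push_cast; rfl
  calc ∫⁻ s in Metric.ball (0 : ℂ) 1, ‖D s‖ₑ ^ 2 * w ‖s‖
      = ∫⁻ s, ‖(Metric.ball (0 : ℂ) 1).indicator D s‖ₑ ^ 2 * w ‖s‖ := by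
        rw [← lintegral_indicator Metric.isOpen_ball.measurableSet]
        refine lintegral_congr fun s => ?_
        by_cases hs : s ∈ Metric.ball (0 : ℂ) 1 <;> simp [hs]
    _ = ∫⁻ r in Ioi (0 : ℝ), ∫⁻ t in Ioo (-Real.pi) Real.pi, ENNReal.ofReal r *
          (‖(Metric.ball (0 : ℂ) 1).indicator D (r * Complex.exp (Complex.I * t))‖ₑ ^ 2 *
            w ‖r * Complex.exp (Complex.I * t)‖) := by
        rw [← Complex.lintegral_comp_polarCoord_symm, polarCoord_target, Measure.volume_eq_prod,
          ← Measure.prod_restrict, lintegral_prod]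
        · simp only [hpol, smul_eq_mul]
        · simp only [hpol, smul_eq_mul]
          refine Measurable.aemeasurable ?_
          exact (by fun_prop : Measurable fun p : ℝ × ℝ => ENNReal.ofReal p.1).mul
            (hf.comp (by fun_prop))
    -- The exponent 2k + 1 is 2k from |s^k|² plus 1 from the polar Jacobian.
    _ = ∫⁻ r in Ioo (0 : ℝ) 1, ENNReal.ofReal (2 * Real.pi) *
          ∑' k, ‖c k‖ₑ ^ 2 * (ENNReal.ofReal (r ^ (2 * k + 1)) * w r) := by
        rw [← lintegral_indicator measurableSet_Ioi, ← lintegral_indicator measurableSet_Ioo]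
        refine lintegral_congr fun r => ?_
        by_cases hr : 0 < r
        swap
        · simp [hr, mem_Ioo]
        have hn : ∀ t : ℝ, ‖r * Complex.exp (Complex.I * t)‖ = r := fun t => by
          rw [norm_mul, mul_comm Complex.I, Complex.norm_exp_ofReal_mul_I, mul_one,
            Complex.norm_real, Real.norm_of_nonneg hr.le]
        by_cases hr1 : r < 1
        swap
        · have : ∀ t : ℝ, (r * Complex.exp (Complex.I * t)) ∉ Metric.ball (0 : ℂ) 1 := fun t => by
            rw [mem_ball_zero_iff, hn]; exact hr1
          simp [hr, hr1, this]
        have hmem : ∀ t : ℝ, (r * Complex.exp (Complex.I * t)) ∈ Metric.ball (0 : ℂ) 1 :=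
          fun t => by rw [mem_ball_zero_iff, hn]; exact hr1
        have ha : Summable fun k => ‖c k * (r : ℂ) ^ k‖ :=
          (hD r (by rwa [Complex.norm_real, Real.norm_of_nonneg hr.le])).summable.norm
        rw [indicator_of_mem (show r ∈ Ioi 0 from hr), indicator_of_mem (show r ∈ Ioo 0 1 from
          ⟨hr, hr1⟩)]
        simp only [hn, indicator_of_mem (hmem _)]
        have hDt : ∀ t : ℝ, D (r * Complex.exp (Complex.I * t)) =
            ∑' k : ℕ, c k * (r : ℂ) ^ k * Complex.exp (Complex.I * k * t) := fun t => by
          rw [← (hD _ (mem_ball_zero_iff.1 (hmem t))).tsum_eq]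
          refine tsum_congr fun k => ?_
          rw [mul_pow, ← Complex.exp_nat_mul, mul_assoc]
          congr 3
          ring
        simp only [hDt]
        rw [lintegral_const_mul' _ _ ENNReal.ofReal_ne_top]
        rw [lintegral_mul_const'', lintegral_sq_tsum_exp ha, ← ENNReal.tsum_mul_left,
          ← ENNReal.tsum_mul_left, ← ENNReal.tsum_mul_right, ← ENNReal.tsum_mul_left]
        · refine tsum_congr fun k => ?_
          rw [enorm_mul, enorm_pow, ← ofReal_norm (r : ℂ), Complex.norm_real,
            Real.norm_of_nonneg hr.le, ENNReal.ofReal_pow hr.le]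
          ring
        · refine Measurable.aemeasurable (Measurable.pow_const (Measurable.enorm ?_) _)
          simp only [← hDt]
          have : (fun t : ℝ => D (r * Complex.exp (Complex.I * t))) = fun t : ℝ =>
              (Metric.ball (0 : ℂ) 1).indicator D (r * Complex.exp (Complex.I * t)) := by
            ext t; rw [indicator_of_mem (hmem t)]
          rw [this]
          exact hDm.comp (by fun_prop)
    _ = _ := by
        rw [lintegral_const_mul' _ _ ENNReal.ofReal_ne_top, lintegral_tsum]
        · congr 1
          refine tsum_congr fun k => ?_
          rw [lintegral_const_mul' _ _ (by simp)]
        · intro k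
          fun_prop

/-- Fubini for the weight `Φ (1 - r)`. -/
lemma lintegral_pow_mul_Phi {φ : ℝ → ℝ} (hφ : AEMeasurable φ (volume.restrict (Ioo (0 : ℝ) 1)))
    (k : ℕ) :
    ENNReal.ofReal (2 * (k + 1)) *
        ∫⁻ r in Ioo (0 : ℝ) 1, ENNReal.ofReal (r ^ (2 * k + 1)) * Phi φ (1 - r) =
      ∫⁻ ε in Ioo (0 : ℝ) 1, ENNReal.ofReal ((1 - ε) ^ (2 * (k + 1)) * φ ε) := by
  set ψ : ℝ → ENNReal := (Ioo (0 : ℝ) 1).indicator (fun ε => ENNReal.ofReal (φ ε)) with hψ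
  have hψm : AEMeasurable ψ := by
    rw [hψ, aemeasurable_indicator_iff measurableSet_Ioo]
    exact hφ.ennreal_ofReal
  set T : Set (ℝ × ℝ) := {p | 0 < p.2 ∧ p.2 < 1 - p.1 ∧ 0 < p.1} with hT
  have hTm : MeasurableSet T :=
    (measurableSet_lt measurable_const measurable_snd).inter
      ((measurableSet_lt measurable_snd (by fun_prop)).inter
        (measurableSet_lt measurable_const measurable_fst))
  have hm : AEMeasurable (Function.uncurry fun r ε : ℝ =>
      T.indicator (fun p => ENNReal.ofReal (p.1 ^ (2 * k + 1)) * ψ p.2) (r, ε))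
      (volume.prod volume) := by
    refine AEMeasurable.indicator ?_ hTm
    exact (by fun_prop : Measurable fun p : ℝ × ℝ =>
      ENNReal.ofReal (p.1 ^ (2 * k + 1))).aemeasurable.mul hψm.comp_snd
  have h1 : ∫⁻ r in Ioo (0 : ℝ) 1, ENNReal.ofReal (r ^ (2 * k + 1)) * Phi φ (1 - r) =
      ∫⁻ r : ℝ, ∫⁻ ε : ℝ,
        T.indicator (fun p => ENNReal.ofReal (p.1 ^ (2 * k + 1)) * ψ p.2) (r, ε) := by
    rw [← lintegral_indicator measurableSet_Ioo]
    refine lintegral_congr fun r => ?_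
    by_cases hr : r ∈ Ioo (0 : ℝ) 1
    · rw [indicator_of_mem hr, Phi, ← lintegral_indicator measurableSet_Ioo,
        ← lintegral_const_mul' _ _ ENNReal.ofReal_ne_top]
      refine lintegral_congr fun ε => ?_
      by_cases he : ε ∈ Ioo 0 (1 - r)
      · rw [indicator_of_mem he, indicator_of_mem (show (r, ε) ∈ T from ⟨he.1, he.2, hr.1⟩)]
      · rw [indicator_of_notMem he, indicator_of_notMem (fun h => he ⟨h.1, h.2.1⟩), mul_zero]
    · rw [indicator_of_notMem hr]
      refine (lintegral_eq_zero_of_ae_eq_zero (Filter.Eventually.of_forall fun ε => ?_)).symm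
      refine indicator_of_notMem (fun h => hr ?_) _
      have := h.1; have := h.2.1; have := h.2.2
      simp only at *
      constructor <;> linarith
  rw [h1, lintegral_lintegral_swap hm, ← lintegral_const_mul' _ _ ENNReal.ofReal_ne_top,
    ← lintegral_indicator measurableSet_Ioo]
  refine lintegral_congr fun ε => ?_
  by_cases he : ε ∈ Ioo (0 : ℝ) 1
  · have h2 : ∀ r : ℝ, T.indicator (fun p => ENNReal.ofReal (p.1 ^ (2 * k + 1)) * ψ p.2) (r, ε) =
        (Ioo 0 (1 - ε)).indicator (fun r => ENNReal.ofReal (r ^ (2 * k + 1))) r * ψ ε := fun r => by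
      by_cases hr : r ∈ Ioo 0 (1 - ε)
      · rw [indicator_of_mem hr, indicator_of_mem (show (r, ε) ∈ T from
          ⟨he.1, show ε < 1 - r by linarith [hr.2], hr.1⟩)]
      · rw [indicator_of_notMem hr, indicator_of_notMem, zero_mul]
        exact fun h => hr ⟨h.2.2, by have := h.2.1; simp only at this; linarith⟩
    -- After the swap, r runs over (0, 1 - ε) for fixed ε; the resulting denominator 2(k + 1)
    -- cancels the prefactor.
    have h3 : ∫⁻ r in Ioo 0 (1 - ε), ENNReal.ofReal (r ^ (2 * k + 1)) =
        ENNReal.ofReal ((1 - ε) ^ (2 * (k + 1)) / (2 * (k + 1))) := by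
      rw [← ofReal_integral_eq_lintegral_ofReal, ← integral_Ioc_eq_integral_Ioo,
        ← intervalIntegral.integral_of_le (by linarith [he.2]), integral_pow]
      · congr 1
        push_cast
        rw [zero_pow (by omega)]
        congr 1 <;> ring
      · exact ((continuous_pow _).integrableOn_Icc).mono_set Ioo_subset_Icc_self
      · exact (ae_restrict_mem measurableSet_Ioo).mono fun r hr => pow_nonneg hr.1.le _
    simp only [h2]
    have h4 : 0 ≤ 1 - ε := by linarith [he.2]
    rw [lintegral_mul_const _ (Measurable.indicator (by fun_prop) measurableSet_Ioo),
      lintegral_indicator measurableSet_Ioo, h3, indicator_of_mem he, hψ, indicator_of_mem he,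
      ← mul_assoc, ← ENNReal.ofReal_mul (by positivity), ← ENNReal.ofReal_mul (by positivity)]
    congr 1
    field_simp
  · rw [indicator_of_notMem he]
    have : ∀ r : ℝ, T.indicator (fun p => ENNReal.ofReal (p.1 ^ (2 * k + 1)) * ψ p.2) (r, ε) = 0 :=
      fun r => by
        by_cases h : (r, ε) ∈ T
        · simp [h, hψ, he]
        · simp [h]
    simp [this]

lemma monotone_Phi (φ : ℝ → ℝ) : Monotone (Phi φ) := fun _ _ h =>
  lintegral_mono_set (Ioo_subset_Ioo_right h)

/-- The weighted sum of coefficients as a weighted Dirichlet integral over the unit disc. -/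
lemma tsum_Gam_mul_sq {φ : ℝ → ℝ} (hφ : AEMeasurable φ (volume.restrict (Ioo (0 : ℝ) 1)))
    {a : ℕ → ℂ} {D : ℂ → ℂ}
    (hD : ∀ s : ℂ, ‖s‖ < 1 → HasSum (fun k : ℕ => ((k : ℂ) + 1) * a (k + 1) * s ^ k) (D s))
    (hDc : ContinuousOn D (Metric.ball 0 1)) :
    ∑' k : ℕ, Gam φ (k + 1) * ‖a (k + 1)‖ₑ ^ 2 =
      ENNReal.ofReal (2 / Real.pi) *
        ∫⁻ s in Metric.ball (0 : ℂ) 1, ‖D s‖ₑ ^ 2 * Phi φ (1 - ‖s‖) := by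
  have hpi := Real.pi_pos
  rw [lintegral_ball_sq_powerSeries (w := fun r => Phi φ (1 - r))
    ((monotone_Phi φ).measurable.comp (by fun_prop)) hD hDc, ← mul_assoc,
    ← ENNReal.ofReal_mul (by positivity), ← ENNReal.tsum_mul_left]
  refine tsum_congr fun k => ?_
  rw [Gam, ← lintegral_pow_mul_Phi hφ]
  have h1 : ‖((k : ℂ) + 1) * a (k + 1)‖ₑ ^ 2 =
      ENNReal.ofReal (((k : ℝ) + 1) ^ 2) * ‖a (k + 1)‖ₑ ^ 2 := by
    rw [enorm_mul, mul_pow, ← ofReal_norm ((k : ℂ) + 1), ENNReal.ofReal_pow (by positivity)]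
    norm_cast
  have h2 : 2 * ((k + 1 : ℕ) : ENNReal) = ENNReal.ofReal (2 * (k + 1)) := by
    rw [ENNReal.ofReal_mul zero_le_two, ENNReal.ofReal_add (by positivity) zero_le_one]
    simp
  rw [h1, h2]
  -- One factor 2(k + 1) belongs to Γ_φ(k + 1), the other to the Fubini identity; together they
  -- account for the (k + 1)² produced by differentiating the series.
  have h3 : ENNReal.ofReal (2 * ((k : ℝ) + 1)) * ENNReal.ofReal (2 * (k + 1)) =
      ENNReal.ofReal (2 / Real.pi * (2 * Real.pi)) * ENNReal.ofReal (((k : ℝ) + 1) ^ 2) := by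
    rw [← ENNReal.ofReal_mul (by positivity), ← ENNReal.ofReal_mul (by positivity)]
    congr 1
    field_simp
  rw [← mul_assoc, h3]
  ring

/-! ### Exponential bounds and shifts of horizontal contours -/

/-- A bound by `exp (a |Re z|)` at infinity in the strip extends to the whole strip. -/
lemma exists_norm_le_exp {h : ℂ → ℂ} (hc : ContinuousOn h strip) {a C R₀ : ℝ}
    (hb : ∀ z ∈ strip, R₀ ≤ |z.re| → ‖h z‖ ≤ C * Real.exp (a * |z.re|)) :
    ∃ C, 0 ≤ C ∧ ∀ z ∈ strip, ‖h z‖ ≤ C * Real.exp (a * |z.re|) := by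
  have hK : IsCompact (Icc (-R₀) R₀ ×ℂ Icc (-1 : ℝ) 1) := isCompact_Icc.reProdIm isCompact_Icc
  have hsub : Icc (-R₀) R₀ ×ℂ Icc (-1 : ℝ) 1 ⊆ strip := fun z hz => abs_le.2 hz.2
  obtain ⟨M, hM⟩ := hK.exists_bound_of_continuousOn
    (f := fun z : ℂ => h z * (Real.exp (-(a * |z.re|)) : ℝ)) ((hc.mono hsub).mul (by fun_prop))
  refine ⟨max |C| M, (abs_nonneg C).trans (le_max_left _ _), fun z hz => ?_⟩
  by_cases hR : R₀ ≤ |z.re|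
  · refine (hb z hz hR).trans ?_
    gcongr
    exact (le_abs_self C).trans (le_max_left _ _)
  · have h1 := hM z ⟨abs_le.1 (not_le.1 hR).le, abs_le.1 hz⟩
    rw [norm_mul, Complex.norm_real, Real.norm_of_nonneg (Real.exp_nonneg _), Real.exp_neg,
      ← div_eq_mul_inv, div_le_iff₀ (Real.exp_pos _)] at h1
    refine h1.trans ?_
    gcongr
    exact le_max_right _ _

lemma integrable_exp_neg_mul_abs {δ : ℝ} (hδ : 0 < δ) :
    Integrable fun x : ℝ => Real.exp (-δ * |x|) := by
  rw [← integrableOn_univ, ← Iic_union_Ioi (a := (0 : ℝ))]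
  refine IntegrableOn.union ?_ ?_
  · refine (integrableOn_exp_mul_Iic hδ 0).congr_fun (fun x hx => ?_) measurableSet_Iic
    simp [abs_of_nonpos (mem_Iic.1 hx)]
  · refine (integrableOn_exp_mul_Ioi (neg_lt_zero.2 hδ) 0).congr_fun (fun x hx => ?_)
      measurableSet_Ioi
    simp [abs_of_pos (mem_Ioi.1 hx)]

/-- A continuous function bounded by `C exp (-δ |x|)` with `δ > 0` is integrable. -/
lemma integrable_of_norm_le_exp {g : ℝ → ℂ} (hg : Continuous g) {C δ : ℝ} (hδ : 0 < δ)
    (hb : ∀ x, ‖g x‖ ≤ C * Real.exp (-δ * |x|)) : Integrable g :=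
  ((integrable_exp_neg_mul_abs hδ).const_mul C).mono' hg.aestronglyMeasurable
    (Filter.Eventually.of_forall hb)

/-- Shift of the horizontal line of integration for an exponentially decaying function. -/
lemma integral_horizontal_eq {h : ℂ → ℂ} {a b C δ : ℝ} (hδ : 0 < δ)
    (hd : DifferentiableOn ℂ h {z | z.im ∈ uIcc a b})
    (hb : ∀ z : ℂ, z.im ∈ uIcc a b → ‖h z‖ ≤ C * Real.exp (-δ * |z.re|)) :
    ∫ x : ℝ, h (x + a * Complex.I) = ∫ x : ℝ, h (x + b * Complex.I) := by
  have hcont : ∀ y ∈ uIcc a b, Continuous fun x : ℝ => h (x + y * Complex.I) := fun y hy => by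
    refine hd.continuousOn.comp_continuous (by fun_prop) fun x => ?_
    simpa using hy
  have hint : ∀ y ∈ uIcc a b, Integrable fun x : ℝ => h (x + y * Complex.I) := fun y hy =>
    integrable_of_norm_le_exp (hcont y hy) (C := C) hδ fun x => by
      simpa using hb (x + y * Complex.I) (by simpa using hy)
  have hlim : ∀ y ∈ uIcc a b, Filter.Tendsto (fun R : ℝ => ∫ x in (-R)..R, h (x + y * Complex.I))
      Filter.atTop (nhds (∫ x : ℝ, h (x + y * Complex.I))) := fun y hy =>
    intervalIntegral_tendsto_integral (hint y hy) Filter.tendsto_neg_atTop_atBot Filter.tendsto_id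
  have hexp : Filter.Tendsto (fun R : ℝ => C * Real.exp (-δ * |R|) * |b - a|)
      Filter.atTop (nhds 0) := by
    have : Filter.Tendsto (fun R : ℝ => -δ * |R|) Filter.atTop Filter.atBot :=
      Filter.tendsto_abs_atTop_atTop.const_mul_atTop_of_neg (neg_lt_zero.2 hδ)
    simpa using ((Real.tendsto_exp_atBot.comp this).const_mul C).mul_const |b - a|
  -- The signs σ = ±1 treat the two vertical sides of the rectangle at once; both contributions
  -- vanish as R → ∞.
  have hvert : ∀ σ : ℝ, |σ| = 1 → Filter.Tendsto
      (fun R : ℝ => ∫ y in a..b, h ((σ * R : ℝ) + y * Complex.I)) Filter.atTop (nhds 0) :=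
    fun σ hσ => by
      refine squeeze_zero_norm (fun R => ?_) hexp
      refine intervalIntegral.norm_integral_le_of_norm_le_const fun y hy => ?_
      have := hb ((σ * R : ℝ) + y * Complex.I) (by simpa using uIoc_subset_uIcc hy)
      simpa [abs_mul, hσ] using this
  have hrect : ∀ R : ℝ, (∫ x in (-R)..R, h (x + a * Complex.I)) =
      (∫ x in (-R)..R, h (x + b * Complex.I)) -
        Complex.I * (∫ y in a..b, h ((1 * R : ℝ) + y * Complex.I)) +
        Complex.I * (∫ y in a..b, h ((-1 * R : ℝ) + y * Complex.I)) := fun R => by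
    have := Complex.integral_boundary_rect_eq_zero_of_differentiableOn h
      ((-R : ℝ) + a * Complex.I) ((R : ℝ) + b * Complex.I) (hd.mono fun z hz => by
        have := hz.2; simpa using this)
    simp at this
    simp
    linear_combination this
  have h2 := (((hlim b right_mem_uIcc).sub ((hvert 1 (by simp)).const_mul Complex.I)).add
    ((hvert (-1) (by simp)).const_mul Complex.I)).congr fun R => (hrect R).symm
  simp only [mul_zero, sub_zero, add_zero] at h2
  exact tendsto_nhds_unique (hlim a left_mem_uIcc) h2

/-! ### The kernel z / sinh(πz/2) on the strip -/

lemma norm_sinh_sq (z : ℂ) :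
    ‖Complex.sinh z‖ ^ 2 = (Real.cosh (2 * z.re) - Real.cos (2 * z.im)) / 2 := by
  have : ‖Complex.sinh z‖ = ‖Complex.sin (z * Complex.I)‖ := by
    rw [Complex.sin_mul_I, norm_mul, Complex.norm_I, mul_one]
  rw [this, norm_sin_sq]
  simp

/-- The holomorphic extension of `sinh (π z / 2) / z` to `z = 0`. -/
noncomputable def sinhQuot : ℂ → ℂ := dslope (fun z : ℂ => Complex.sinh (Real.pi * z / 2)) 0

lemma sinhQuot_of_ne {z : ℂ} (hz : z ≠ 0) : sinhQuot z = Complex.sinh (Real.pi * z / 2) / z := by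
  rw [sinhQuot, dslope_of_ne _ hz, slope_def_field]
  simp

lemma differentiable_sinhQuot : Differentiable ℂ sinhQuot := by
  have : DifferentiableOn ℂ sinhQuot univ :=
    (Complex.differentiableOn_dslope Filter.univ_mem).2 (by fun_prop)
  exact differentiableOn_univ.1 this

/-- The zeros of sinh(πz/2) are the points of 2iℤ. Only 0 lies in the strip, and there the quotient
equals π/2. -/
lemma sinhQuot_ne_zero {z : ℂ} (hz : z ∈ strip) : sinhQuot z ≠ 0 := by
  have hpi := Real.pi_pos
  by_cases h0 : z = 0
  · subst h0
    have : HasDerivAt (fun z : ℂ => Complex.sinh (Real.pi * z / 2))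
        (Complex.cosh (Real.pi * 0 / 2) * (Real.pi * 1 / 2)) 0 :=
      (((hasDerivAt_id (0 : ℂ)).const_mul (Real.pi : ℂ)).div_const 2).csinh
    rw [sinhQuot, dslope_same, this.deriv]
    simp [hpi.ne']
  · rw [sinhQuot_of_ne h0]
    refine div_ne_zero (fun h => h0 ?_) h0
    have h1 := norm_sinh_sq (Real.pi * z / 2)
    rw [h] at h1
    have e1 : 2 * (Real.pi * z / 2 : ℂ).re = Real.pi * z.re := by simp; ring
    have e2 : 2 * (Real.pi * z / 2 : ℂ).im = Real.pi * z.im := by simp; ring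
    rw [e1, e2, norm_zero] at h1
    have h2 := Real.one_le_cosh (Real.pi * z.re)
    have h3 := Real.cos_le_one (Real.pi * z.im)
    have h4 : Real.cos (Real.pi * z.im) = 1 := by linarith
    have h5 : z.re = 0 := by
      by_contra hne
      have := Real.one_lt_cosh.2 (mul_ne_zero hpi.ne' hne)
      linarith
    have h6 := abs_le.1 (show |z.im| ≤ 1 from hz)
    have h7 := (Real.cos_eq_one_iff_of_lt_of_lt (by nlinarith) (by nlinarith)).1 h4
    exact Complex.ext h5 (by simpa [hpi.ne'] using h7)

/-- In the strip `|Im z| ≤ 1` the function `z / sinh (π z / 2)` is `O (exp (-β |Re z|))` for every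
`β < π / 2`. -/
lemma exists_norm_inv_sinhQuot_le {β : ℝ} (hβ : β < Real.pi / 2) :
    ∃ C, 0 ≤ C ∧ ∀ z ∈ strip, ‖(sinhQuot z)⁻¹‖ ≤ C * Real.exp (-β * |z.re|) := by
  have hpi := Real.pi_gt_three
  set δ := Real.pi / 2 - β with hδ
  have hδ0 : 0 < δ := by linarith
  -- For t = |Re z| ≥ 1 one has |z| ≤ 2t and |sinh(πz/2)| ≥ e^{πt/2}/4. The remaining factor t is
  -- absorbed by δt ≤ e^{δt}, whence 8/δ.
  refine exists_norm_le_exp (C := 8 / δ) (R₀ := 1)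
    (differentiable_sinhQuot.continuous.continuousOn.inv₀ fun z hz => sinhQuot_ne_zero hz)
    fun z hz h1 => ?_
  have hz0 : z ≠ 0 := by rintro rfl; simp at h1; linarith
  set t := |z.re| with ht
  have hn : ‖z‖ ≤ 2 * t := by
    have := Complex.norm_le_abs_re_add_abs_im z
    have h2 : |z.im| ≤ 1 := hz
    linarith
  have hs : Real.sinh (Real.pi / 2 * t) ≤ ‖Complex.sinh (Real.pi * z / 2)‖ := by
    refine le_of_sq_le_sq ?_ (norm_nonneg _)
    rw [norm_sinh_sq]
    have e1 : 2 * (Real.pi * z / 2 : ℂ).re = 2 * (Real.pi / 2 * z.re) := by simp; ring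
    rw [e1, Real.cosh_two_mul, Real.cosh_sq]
    have : Real.sinh (Real.pi / 2 * t) ^ 2 = Real.sinh (Real.pi / 2 * z.re) ^ 2 := by
      rcases abs_choice z.re with h | h <;> rw [ht, h]
      rw [mul_neg, Real.sinh_neg, neg_sq]
    rw [this]
    linarith [Real.cos_le_one (2 * (Real.pi * z / 2 : ℂ).im)]
  have hsinh : Real.exp (Real.pi / 2 * t) / 4 ≤ Real.sinh (Real.pi / 2 * t) := by
    rw [Real.sinh_eq]
    have h2 : 1 ≤ Real.pi / 2 * t := by nlinarith
    have h3 : 2 ≤ Real.exp (Real.pi / 2 * t) := by linarith [Real.add_one_le_exp (Real.pi / 2 * t)]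
    have h4 : Real.exp (-(Real.pi / 2 * t)) ≤ 1 := Real.exp_le_one_iff.2 (by linarith)
    linarith
  have hE := Real.exp_pos (Real.pi / 2 * t)
  rw [Pi.inv_apply, sinhQuot_of_ne hz0, inv_div, norm_div]
  calc ‖z‖ / ‖Complex.sinh (Real.pi * z / 2)‖ ≤ (2 * t) / (Real.exp (Real.pi / 2 * t) / 4) := by
        gcongr
        exact hsinh.trans hs
    _ = 8 / δ * (δ * t) * Real.exp (-(Real.pi / 2 * t)) := by
        rw [Real.exp_neg]; field_simp; ring
    _ ≤ 8 / δ * Real.exp (δ * t) * Real.exp (-(Real.pi / 2 * t)) := by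
        gcongr
        linarith [Real.add_one_le_exp (δ * t)]
    _ = 8 / δ * Real.exp (-β * t) := by
        rw [mul_assoc, ← Real.exp_add, hδ]
        congr 2
        ring

/-! ### The Fourier transform of K_u Δ_f by contour shift -/

lemma ClassF1.continuousOn {f : ℂ → ℂ} (hf : ClassF1 f) : ContinuousOn f strip := by
  obtain ⟨U, _, hU, hd⟩ := hf.holomorphic
  exact hd.continuousOn.mono hU

lemma ClassF1.continuous_horizontal {f : ℂ → ℂ} (hf : ClassF1 f) {y : ℝ} (hy : |y| ≤ 1) :
    Continuous fun x : ℝ => f (x + y * Complex.I) :=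
  hf.continuousOn.comp_continuous (by fun_prop) fun x => by simpa [strip] using hy

lemma ClassF1.continuous_ofReal {f : ℂ → ℂ} (hf : ClassF1 f) :
    Continuous fun x : ℝ => f x := by
  simpa using hf.continuous_horizontal (y := 0) (by simp)

lemma ClassF1.exists_norm_le {f : ℂ → ℂ} (hf : ClassF1 f) :
    ∃ α < Real.pi / 4, ∃ C, 0 ≤ C ∧ ∀ z ∈ strip, ‖f z‖ ≤ C * Real.exp (α * |z.re|) := by
  obtain ⟨α, hα, C, R₀, hb⟩ := hf.growth
  refine ⟨α, hα, exists_norm_le_exp (C := C) (R₀ := R₀) hf.continuousOn fun z hz hR => ?_⟩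
  simpa using hb z.re z.im hR hz

lemma norm_exp_real_mul_le {θ : ℂ} (hθ : |θ.re| ≤ Real.pi / 4) (x : ℝ) :
    ‖Complex.exp (x * θ)‖ ≤ Real.exp (Real.pi / 4 * |x|) := by
  rw [Complex.norm_exp]
  refine Real.exp_le_exp.2 ?_
  rw [Complex.re_ofReal_mul, mul_comm]
  refine (le_abs_self _).trans ?_
  rw [abs_mul]
  gcongr

lemma norm_exp_mul_le {θ : ℂ} (hθ : |θ.re| ≤ Real.pi / 4) {z : ℂ} (hz : z ∈ strip) :
    ‖Complex.exp (z * θ)‖ ≤ Real.exp (Real.pi / 4 * |z.re|) * Real.exp |θ.im| := by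
  have : z * θ = z.re * θ + z.im * Complex.I * θ := by
    rw [← add_mul, Complex.re_add_im]
  rw [this, Complex.exp_add, norm_mul]
  gcongr
  · exact norm_exp_real_mul_le hθ _
  · rw [Complex.norm_exp]
    refine Real.exp_le_exp.2 ?_
    have : (z.im * Complex.I * θ).re = -(z.im * θ.im) := by simp
    rw [this]
    refine (neg_le_abs _).trans ?_
    rw [abs_mul]
    exact mul_le_of_le_one_left (abs_nonneg _) hz

/-- The growth rates α of f and π/4 of the exponential add up to less than π/2, so a decay rate β <
π/2 of the kernel beats them even when |Re θ| = π/4; half of the gap π/4 - α is left as δ. Two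
points with equal real part occur because f and the kernel are evaluated on different horizontal
lines. -/
lemma exists_exp_bound {f : ℂ → ℂ} (hf : ClassF1 f) :
    ∃ C δ, 0 < δ ∧ ∀ z ∈ strip, ∀ w ∈ strip, w.re = z.re → ∀ θ : ℂ, |θ.re| ≤ Real.pi / 4 →
      ‖f z * Complex.exp (w * θ) * (sinhQuot w)⁻¹‖ ≤
        C * Real.exp |θ.im| * Real.exp (-δ * |z.re|) := by
  obtain ⟨α, hα, C, hC, hfb⟩ := hf.exists_norm_le
  obtain ⟨B, hB, hqb⟩ := exists_norm_inv_sinhQuot_le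
    (β := Real.pi / 2 - (Real.pi / 4 - α) / 2) (by linarith)
  refine ⟨C * B, (Real.pi / 4 - α) / 2, by linarith, fun z hz w hw hwz θ hθ => ?_⟩
  have h1 := norm_exp_mul_le hθ hw
  have h2 := hqb w hw
  rw [hwz] at h1 h2
  rw [norm_mul, norm_mul]
  calc _ ≤ (C * Real.exp (α * |z.re|)) * (Real.exp (Real.pi / 4 * |z.re|) * Real.exp |θ.im|) *
        (B * Real.exp (-(Real.pi / 2 - (Real.pi / 4 - α) / 2) * |z.re|)) := by
        gcongr
        exact hfb z hz
    _ = C * B * Real.exp |θ.im| * (Real.exp (α * |z.re|) * Real.exp (Real.pi / 4 * |z.re|) *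
        Real.exp (-(Real.pi / 2 - (Real.pi / 4 - α) / 2) * |z.re|)) := by ring
    _ = _ := by
        rw [← Real.exp_add, ← Real.exp_add]
        congr 2
        ring

lemma ofReal_mem_strip (x : ℝ) : (x : ℂ) ∈ strip := by simp [strip]

/-- The integrand `f (x + c i) exp (x θ) x / sinh (π x / 2)` is integrable. -/
lemma integrable_shifted {f : ℂ → ℂ} (hf : ClassF1 f) {c : ℝ} (hc : |c| = 1) {θ : ℂ}
    (hθ : |θ.re| ≤ Real.pi / 4) :
    Integrable fun x : ℝ => f (x + c * Complex.I) * Complex.exp (x * θ) * (sinhQuot x)⁻¹ := by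
  obtain ⟨C, δ, hδ, hb⟩ := exists_exp_bound hf
  refine integrable_of_norm_le_exp (C := C * Real.exp |θ.im|) ?_ hδ fun x => ?_
  · refine ((hf.continuous_horizontal hc.le).mul (by fun_prop)).mul (Continuous.inv₀ ?_ ?_)
    · exact differentiable_sinhQuot.continuous.comp Complex.continuous_ofReal
    · exact fun x => sinhQuot_ne_zero (ofReal_mem_strip x)
  · simpa using hb (x + c * Complex.I) (by simp [strip, hc]) x (ofReal_mem_strip x) (by simp) θ hθ

/-- A vertical shift by c = ±1 moves πz/2 by a quarter of the period of sinh: sinh(π(x - ci)/2) =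
-ci cosh(πx/2). This is how the density of ν appears. -/
lemma inv_sinhQuot_sub {c : ℝ} (hc : c = 1 ∨ c = -1) (x : ℝ) :
    (sinhQuot (x - c * Complex.I))⁻¹ =
      c * Complex.I * (x - c * Complex.I) / Real.cosh (Real.pi * x / 2) := by
  have hne : (x - c * Complex.I : ℂ) ≠ 0 := fun h => by
    have := congrArg Complex.im h
    simp at this
    rcases hc with h | h <;> linarith
  have hcosh : Complex.cosh (Real.pi * x / 2) ≠ 0 := by
    have := (Real.cosh_pos (Real.pi * x / 2)).ne'
    intro h
    apply this
    exact_mod_cast h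
  have hs : Complex.sinh (Real.pi * (x - c * Complex.I) / 2) =
      -(c * Complex.I) * Complex.cosh (Real.pi * x / 2) := by
    rw [show (Real.pi * (x - c * Complex.I) / 2 : ℂ) =
      Real.pi * x / 2 - (c * (Real.pi / 2) : ℂ) * Complex.I by ring, Complex.sinh_sub,
      Complex.sinh_mul_I, Complex.cosh_mul_I]
    rcases hc with rfl | rfl <;> simp <;> ring
  have hcc : (c : ℂ) * c = 1 := by rcases hc with rfl | rfl <;> simp
  have hc0 : (c : ℂ) ≠ 0 := by rcases hc with rfl | rfl <;> simp
  rw [sinhQuot_of_ne hne, inv_div, hs]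
  push_cast
  rw [div_eq_div_iff (by simp [hc0, hcosh]) hcosh]
  linear_combination (-(x - c * Complex.I) * Complex.cosh (Real.pi * x / 2)) * hcc +
    (c * c * (x - c * Complex.I) * Complex.cosh (Real.pi * x / 2)) * Complex.I_mul_I

/-- Contour shift from `ℝ + c i`, `c = ± 1`, to the real line. -/
lemma integral_shifted {f : ℂ → ℂ} (hf : ClassF1 f) {c : ℝ} (hc : c = 1 ∨ c = -1) {θ : ℂ}
    (hθ : |θ.re| ≤ Real.pi / 4) :
    Integrable (fun x : ℝ => f x * Complex.exp ((x - c * Complex.I) * θ) *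
      (c * Complex.I * (x - c * Complex.I) / Real.cosh (Real.pi * x / 2))) ∧
    ∫ x : ℝ, f (x + c * Complex.I) * Complex.exp (x * θ) * (sinhQuot x)⁻¹ =
      ∫ x : ℝ, f x * Complex.exp ((x - c * Complex.I) * θ) *
        (c * Complex.I * (x - c * Complex.I) / Real.cosh (Real.pi * x / 2)) := by
  obtain ⟨C, δ, hδ, hb⟩ := exists_exp_bound hf
  obtain ⟨U, hUo, hU, hd⟩ := hf.holomorphic
  have him : ∀ y ∈ uIcc 0 c, |y| ≤ 1 ∧ |y - c| ≤ 1 := fun y hy => by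
    rcases hc with rfl | rfl
    · rw [uIcc_of_le zero_le_one] at hy
      rw [abs_le, abs_le]
      refine ⟨⟨?_, ?_⟩, ⟨?_, ?_⟩⟩ <;> linarith [hy.1, hy.2]
    · rw [uIcc_of_ge (by norm_num)] at hy
      rw [abs_le, abs_le]
      refine ⟨⟨?_, ?_⟩, ⟨?_, ?_⟩⟩ <;> linarith [hy.1, hy.2]
  have hm : ∀ z : ℂ, z.im ∈ uIcc 0 c → z ∈ strip ∧ z - c * Complex.I ∈ strip := fun z hz =>
    ⟨(him _ hz).1, by simpa [strip] using (him _ hz).2⟩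
  -- The kernel is recentred at ci: on Im z = c it is the sinh kernel, on Im z = 0 the cosh kernel,
  -- and in between both z and z - ci stay in the strip.
  set h : ℂ → ℂ := fun z =>
    f z * Complex.exp ((z - c * Complex.I) * θ) * (sinhQuot (z - c * Complex.I))⁻¹ with hh
  have hhb : ∀ z : ℂ, z.im ∈ uIcc 0 c →
      ‖h z‖ ≤ C * Real.exp |θ.im| * Real.exp (-δ * |z.re|) := fun z hz =>
    hb z (hm z hz).1 _ (hm z hz).2 (by simp) θ hθ
  have hhd : DifferentiableOn ℂ h {z | z.im ∈ uIcc 0 c} := by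
    refine ((hd.mono fun z hz => hU (hm z hz).1).mul (by fun_prop)).mul
      (DifferentiableOn.inv ?_ fun z hz => sinhQuot_ne_zero (hm z hz).2)
    exact (differentiable_sinhQuot.comp (by fun_prop)).differentiableOn
  have key := integral_horizontal_eq hδ hhd hhb
  have e0 : ∀ x : ℝ, h (x + (0 : ℝ) * Complex.I) = f x * Complex.exp ((x - c * Complex.I) * θ) *
      (c * Complex.I * (x - c * Complex.I) / Real.cosh (Real.pi * x / 2)) := fun x => by
    rw [Complex.ofReal_zero, zero_mul, add_zero, hh, ← inv_sinhQuot_sub hc]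
  have e1 : ∀ x : ℝ, h (x + c * Complex.I) =
      f (x + c * Complex.I) * Complex.exp (x * θ) * (sinhQuot x)⁻¹ := fun x => by
    simp only [hh, add_sub_cancel_right]
  simp only [e0, e1] at key
  refine ⟨?_, key.symm⟩
  simp only [← e0]
  refine integrable_of_norm_le_exp (C := C * Real.exp |θ.im|) ?_ hδ fun x => ?_
  · exact hhd.continuousOn.comp_continuous (by fun_prop) fun x => by simp
  · simpa using hhb (x + (0 : ℝ) * Complex.I) (by simp)

lemma ofReal_Ker {x : ℝ} (hx : x ≠ 0) (u : ℝ) :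
    (Ker u x : ℂ) = Complex.exp (x * u) * (sinhQuot x)⁻¹ := by
  rw [sinhQuot_of_ne (by exact_mod_cast hx), Ker, inv_div]
  push_cast
  ring_nf

/-- Growth parameter and frequency merge into one complex exponent u + iv. Equality may fail at x =
0, where `Ker` has the value 0/0 = 0 and `sinhQuot` the true limit. -/
lemma Ker_mul_Del_ae_eq (f : ℂ → ℂ) (u v : ℝ) :
    (fun x : ℝ => (Ker u x : ℂ) * Del f x * Complex.exp (Complex.I * x * v)) =ᵐ[volume]
      fun x : ℝ =>
        f (x + (1 : ℝ) * Complex.I) * Complex.exp (x * (u + v * Complex.I)) * (sinhQuot x)⁻¹ -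
        f (x + (-1 : ℝ) * Complex.I) * Complex.exp (x * (u + v * Complex.I)) * (sinhQuot x)⁻¹ := by
  filter_upwards [Measure.ae_ne volume (0 : ℝ)] with x hx
  rw [ofReal_Ker hx, Del, mul_add, Complex.exp_add,
    show Complex.I * (x : ℂ) * v = x * (v * Complex.I) by ring]
  push_cast
  rw [one_mul, neg_one_mul, ← sub_eq_add_neg]
  ring

lemma integrable_Ker_mul_Del {f : ℂ → ℂ} (hf : ClassF1 f) {u : ℝ} (hu : |u| ≤ Real.pi / 4) :
    Integrable fun x : ℝ => (Ker u x : ℂ) * Del f x := by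
  have h := Ker_mul_Del_ae_eq f u 0
  simp only [Complex.ofReal_zero, mul_zero, Complex.exp_zero, mul_one] at h
  refine Integrable.congr ?_ h.symm
  exact (integrable_shifted hf (by simp) (by simpa using hu)).sub
    (integrable_shifted hf (by simp) (by simpa using hu))

/-- The Fourier transform of `K_u Δ_f`, expressed by integrals over the real line. -/
lemma fourierHat_eq {f : ℂ → ℂ} (hf : ClassF1 f) {θ : ℂ} (hθ : |θ.re| ≤ Real.pi / 4) :
    fourierHat (fun x => (Ker θ.re x : ℂ) * Del f x) θ.im =
      ∫ x : ℝ, 4 * Complex.I * (1 / (2 * Real.cosh (Real.pi * x / 2)) : ℝ) *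
        (f x * Complex.exp (x * θ) * (x * Complex.cos θ - Complex.sin θ)) := by
  obtain ⟨i1, e1⟩ := integral_shifted hf (c := 1) (Or.inl rfl) hθ
  obtain ⟨i2, e2⟩ := integral_shifted hf (c := -1) (Or.inr rfl) hθ
  rw [fourierHat, integral_congr_ae (Ker_mul_Del_ae_eq f _ _)]
  simp only [Complex.re_add_im]
  rw [integral_sub (integrable_shifted hf (by simp) hθ) (integrable_shifted hf (by simp) hθ),
    e1, e2, ← integral_sub i1 i2]
  congr 1 with x
  have hcosh : (Real.cosh (Real.pi * x / 2) : ℂ) ≠ 0 := by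
    exact_mod_cast (Real.cosh_pos (Real.pi * x / 2)).ne'
  -- The factors e^{∓iθ} combine by Euler's formula into 2(x cos θ - sin θ); the other 2 in 4i comes
  -- from the density 1/(2 cosh).
  have h1 : ((x : ℂ) - (1 : ℝ) * Complex.I) * θ = x * θ + -(θ * Complex.I) := by push_cast; ring
  have h2 : ((x : ℂ) - (-1 : ℝ) * Complex.I) * θ = x * θ + θ * Complex.I := by push_cast; ring
  rw [h1, h2, Complex.exp_add, Complex.exp_add, ← neg_mul, Complex.exp_mul_I, Complex.exp_mul_I,
    Complex.cos_neg, Complex.sin_neg]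
  push_cast [-Complex.ofReal_cosh]
  field_simp
  ring_nf
  simp only [Complex.I_sq]
  ring

/-! ### The generating function and the Meixner–Pollaczek polynomials -/

lemma differentiableAt_arctan {s : ℂ} (hs : ‖s‖ < 1) : DifferentiableAt ℂ Complex.arctan s := by
  have h1 : (1 + s * Complex.I) ∈ Complex.slitPlane :=
    Complex.mem_slitPlane_of_norm_lt_one (by simpa)
  have h2 : (1 + -(s * Complex.I)) ∈ Complex.slitPlane :=
    Complex.mem_slitPlane_of_norm_lt_one (by simpa)
  have h3 : (Complex.arctan : ℂ → ℂ) =ᶠ[nhds s] fun s => -Complex.I / 2 *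
      (Complex.log (1 + s * Complex.I) + -Complex.log (1 + -(s * Complex.I))) := by
    filter_upwards [(isOpen_lt continuous_norm continuous_const).mem_nhds hs] with w hw
    rw [Complex.arctan, ← Complex.hasSum_arctan_aux hw, sub_eq_add_neg]
  refine DifferentiableAt.congr_of_eventuallyEq ?_ h3
  exact (((by fun_prop : DifferentiableAt ℂ (fun s => 1 + s * Complex.I) s).clog h1).add
    ((by fun_prop : DifferentiableAt ℂ (fun s => 1 + -(s * Complex.I)) s).clog h2).neg).const_mul _

/-- Here 1 + tan² θ = (1/cos θ)², and Re (1/cos θ) > 0 on the strip, so the principal square root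
returns 1/cos θ itself. -/
lemma genFun_tan {θ : ℂ} (hθ : θ ∈ vstrip) (x : ℂ) :
    genFun x (Complex.tan θ) = Complex.exp (x * θ) * Complex.cos θ := by
  have hc := cos_ne_zero hθ
  have h1 : 1 + Complex.tan θ ^ 2 = (Complex.cos θ)⁻¹ ^ (2 : ℕ) := by
    rw [Complex.tan_eq_sin_div_cos, div_pow, inv_pow]
    field_simp
    rw [add_comm, Complex.sin_sq_add_cos_sq]
  have h2 : 0 < ((Complex.cos θ)⁻¹).re := by
    rw [Complex.inv_re]
    exact div_pos (cos_re_pos hθ) (Complex.normSq_pos.2 hc)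
  rw [genFun, arctan_tan_of_mem hθ, h1, one_div, Complex.sq_cpow_two_inv h2, div_inv_eq_mul]

lemma genFun_eq {s : ℂ} (hs : ‖s‖ < 1) (x : ℂ) :
    genFun x s = Complex.exp (x * Complex.arctan s) * Complex.cos (Complex.arctan s) := by
  conv_lhs => rw [← tan_arctan_of_norm_lt_one hs]
  exact genFun_tan (arctan_mem_vstrip hs) x

lemma differentiableOn_genFun (x : ℂ) : DifferentiableOn ℂ (genFun x) (Metric.ball 0 1) := by
  have h : DifferentiableOn ℂ Complex.arctan (Metric.ball 0 1) := fun s hs =>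
    (differentiableAt_arctan (mem_ball_zero_iff.1 hs)).differentiableWithinAt
  refine DifferentiableOn.congr ?_ fun s hs => genFun_eq (mem_ball_zero_iff.1 hs) x
  exact (h.const_mul x).cexp.mul h.ccos

lemma diffContOnCl_genFun (x : ℂ) {ρ : ℝ} (hρ1 : ρ < 1) :
    DiffContOnCl ℂ (genFun x) (Metric.ball 0 ρ) := by
  have : DifferentiableOn ℂ (genFun x) (Metric.closedBall 0 ρ) :=
    (differentiableOn_genFun x).mono (Metric.closedBall_subset_ball hρ1)
  exact (this.mono Metric.closure_ball_subset_closedBall).diffContOnCl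

lemma hasSum_mpPoly (x : ℂ) {s : ℂ} (hs : ‖s‖ < 1) :
    HasSum (fun k => mpPoly k x * s ^ k) (genFun x s) := by
  have := Complex.hasSum_taylorSeries_on_ball (differentiableOn_genFun x) (mem_ball_zero_iff.2 hs)
  refine this.congr_fun fun k => ?_
  simp only [mpPoly, sub_zero, smul_eq_mul]
  ring

/-- Cauchy estimate for the Meixner-Pollaczek polynomials. -/
lemma exists_norm_mpPoly_le {ρ : ℝ} (hρ : 0 < ρ) (hρ1 : ρ < 1) :
    ∃ M, ∀ (k : ℕ) (x : ℝ), ‖mpPoly k x‖ ≤ M * Real.exp (Real.pi / 4 * |x|) / ρ ^ k := by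
  have hcont : ContinuousOn (fun s => Complex.cos (Complex.arctan s)) (Metric.sphere 0 ρ) := by
    intro s hs
    have hs1 : ‖s‖ < 1 := by rw [mem_sphere_zero_iff_norm.1 hs]; exact hρ1
    exact (differentiableAt_arctan hs1).ccos.continuousAt.continuousWithinAt
  obtain ⟨M, hM⟩ := (isCompact_sphere (0 : ℂ) ρ).exists_bound_of_continuousOn hcont
  refine ⟨M, fun k x => ?_⟩
  have := Complex.norm_iteratedDeriv_le_of_forall_mem_sphere_norm_le k hρ
    (diffContOnCl_genFun x hρ1) (C := M * Real.exp (Real.pi / 4 * |x|)) fun s hs => by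
      have hs1 : ‖s‖ < 1 := by rw [mem_sphere_zero_iff_norm.1 hs]; exact hρ1
      rw [genFun_eq hs1, norm_mul, mul_comm]
      have h1 := hM s hs
      have h2 := norm_exp_real_mul_le
        (le_of_lt (show |(Complex.arctan s).re| < _ from arctan_mem_vstrip hs1)) x
      gcongr
      exact (norm_nonneg _).trans h1
  have hk : (0 : ℝ) < k.factorial := by exact_mod_cast k.factorial_pos
  rw [mpPoly, norm_div, RCLike.norm_natCast, div_le_iff₀ hk]
  exact this.trans_eq (by ring)

/-- Cauchy's formula on the circle of radius 1/2 makes the dependence on x explicit, as a parameter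
integral. Continuity provides the measurability needed to integrate termwise in `hasSum_coeff`. -/
lemma continuous_mpPoly (k : ℕ) : Continuous fun x : ℝ => mpPoly k x := by
  have hρ : (0 : ℝ) < 1 / 2 := by norm_num
  have hρ1 : (1 / 2 : ℝ) < 1 := by norm_num
  have hc1 : ∀ t, ‖circleMap 0 (1 / 2) t‖ < 1 := fun t => by
    rw [norm_circleMap_zero, abs_of_pos hρ]; exact hρ1
  have hc0 : ∀ t, circleMap 0 (1 / 2) t ≠ 0 := fun t => circleMap_ne_center hρ.ne'
  have harc : Continuous fun t => Complex.arctan (circleMap 0 (1 / 2) t) := by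
    refine continuous_iff_continuousAt.2 fun t => ?_
    exact ContinuousAt.comp (f := circleMap 0 (1 / 2)) (differentiableAt_arctan (hc1 t)).continuousAt
      (continuous_circleMap 0 (1 / 2)).continuousAt
  have h : ∀ x : ℝ, (2 * Real.pi * Complex.I / k.factorial : ℂ) * iteratedDeriv k (genFun x) 0 =
      ∫ t in (0 : ℝ)..2 * Real.pi, circleMap 0 (1 / 2) t * Complex.I *
        (1 / circleMap 0 (1 / 2) t ^ (k + 1) * (Complex.exp (x * Complex.arctan
          (circleMap 0 (1 / 2) t)) * Complex.cos (Complex.arctan (circleMap 0 (1 / 2) t)))) :=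
    fun x => by
      rw [← smul_eq_mul, ← DiffContOnCl.circleIntegral_one_div_sub_center_pow_smul hρ k
        (diffContOnCl_genFun x hρ1), circleIntegral]
      simp only [deriv_circleMap, smul_eq_mul, sub_zero, genFun_eq (hc1 _)]
  have hcont : Continuous fun x : ℝ =>
      (2 * Real.pi * Complex.I / k.factorial : ℂ) * iteratedDeriv k (genFun x) 0 := by
    simp only [h]
    refine intervalIntegral.continuous_parametric_intervalIntegral_of_continuous' ?_ _ _
    have h1 : Continuous fun p : ℝ × ℝ => circleMap 0 (1 / 2) p.2 :=
      (continuous_circleMap 0 (1 / 2)).comp continuous_snd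
    have h2 : Continuous fun p : ℝ × ℝ => Complex.arctan (circleMap 0 (1 / 2) p.2) :=
      harc.comp continuous_snd
    refine (h1.mul continuous_const).mul (Continuous.mul ?_ ?_)
    · exact continuous_const.div (h1.pow _) fun p => pow_ne_zero _ (hc0 _)
    · exact ((Complex.continuous_ofReal.comp continuous_fst).mul h2).cexp.mul
        (Complex.continuous_cos.comp h2)
  have hne : (2 * Real.pi * Complex.I / k.factorial : ℂ) ≠ 0 := by
    simp [Real.pi_ne_zero, Nat.factorial_ne_zero]
  have := (hcont.const_mul (2 * Real.pi * Complex.I / k.factorial : ℂ)⁻¹).div_const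
    (k.factorial : ℂ)
  refine this.congr fun x => ?_
  rw [inv_mul_cancel_left₀ hne]
  rfl

/-! ### The coefficients f_k, their power series and the Laplace transform of f -/

lemma integral_nu (g : ℝ → ℂ) :
    ∫ x, g x ∂nu = ∫ x : ℝ, (1 / (2 * Real.cosh (Real.pi * x / 2)) : ℝ) * g x := by
  rw [nu, integral_withDensity_eq_integral_toReal_smul (by fun_prop)
    (Filter.Eventually.of_forall fun x => ENNReal.ofReal_lt_top)]
  refine integral_congr_ae (Filter.Eventually.of_forall fun x => ?_)
  have := Real.cosh_pos (Real.pi * x / 2)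
  simp only
  rw [ENNReal.toReal_ofReal (by positivity), Complex.real_smul]

lemma integrable_exp_nu {γ : ℝ} (hγ : γ < Real.pi / 2) :
    Integrable (fun x : ℝ => Real.exp (γ * |x|)) nu := by
  rw [nu, integrable_withDensity_iff_integrable_smul' (by fun_prop)
    (Filter.Eventually.of_forall fun x => ENNReal.ofReal_lt_top)]
  have hm : AEStronglyMeasurable (fun x : ℝ =>
      (ENNReal.ofReal (1 / (2 * Real.cosh (Real.pi * x / 2)))).toReal • Real.exp (γ * |x|))
      volume := by
    refine Measurable.aestronglyMeasurable ?_
    fun_prop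
  refine (integrable_exp_neg_mul_abs (δ := Real.pi / 2 - γ) (by linarith)).mono' hm
    (Filter.Eventually.of_forall fun x => ?_)
  have h0 := Real.cosh_pos (Real.pi * x / 2)
  have h1 : Real.exp (Real.pi / 2 * |x|) ≤ 2 * Real.cosh (Real.pi * x / 2) := by
    rw [← Real.cosh_abs, Real.cosh_eq]
    have : |Real.pi * x / 2| = Real.pi / 2 * |x| := by
      rw [mul_div_right_comm, abs_mul, abs_of_pos (by positivity)]
    rw [this]
    linarith [Real.exp_pos (-(Real.pi / 2 * |x|))]
  rw [ENNReal.toReal_ofReal (by positivity), smul_eq_mul, Real.norm_of_nonneg (by positivity)]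
  calc _ ≤ 1 / Real.exp (Real.pi / 2 * |x|) * Real.exp (γ * |x|) := by gcongr
    _ = _ := by
      rw [one_div, ← Real.exp_neg, ← Real.exp_add]
      congr 1
      ring

/-- One function dominates the θ-derivatives for every θ in the strip at once. As α + π/4 < π/2, a
spare rate δ absorbs the factor 1 + |x| created by differentiating e^{xθ}. -/
lemma integrable_weight {f : ℂ → ℂ} (hf : ClassF1 f) :
    Integrable (fun x : ℝ => (1 + |x|) * (‖f x‖ * Real.exp (Real.pi / 4 * |x|))) nu := by
  obtain ⟨α, hα, C, hC, hb⟩ := hf.exists_norm_le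
  set δ := (Real.pi / 4 - α) / 2 with hδ
  have hδ0 : 0 < δ := by linarith
  have hcont := hf.continuous_ofReal
  refine ((integrable_exp_nu (γ := Real.pi / 2 - δ) (by linarith)).const_mul
    ((1 + 1 / δ) * C)).mono' (Continuous.aestronglyMeasurable ((by fun_prop :
      Continuous fun x : ℝ => 1 + |x|).mul (hcont.norm.mul (by fun_prop))))
    (Filter.Eventually.of_forall fun x => ?_)
  rw [Real.norm_of_nonneg (by positivity)]
  have h1 := hb x (ofReal_mem_strip x)
  rw [Complex.ofReal_re] at h1
  have h2 : 1 + |x| ≤ (1 + 1 / δ) * Real.exp (δ * |x|) := by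
    have h3 := Real.add_one_le_exp (δ * |x|)
    have h4 : 1 ≤ Real.exp (δ * |x|) := Real.one_le_exp (by positivity)
    have h5 : |x| ≤ 1 / δ * Real.exp (δ * |x|) := by
      rw [one_div_mul_eq_div, le_div_iff₀ hδ0]; linarith
    linarith
  calc _ ≤ (1 + 1 / δ) * Real.exp (δ * |x|) *
        (C * Real.exp (α * |x|) * Real.exp (Real.pi / 4 * |x|)) := by gcongr
    _ = (1 + 1 / δ) * C *
        (Real.exp (δ * |x|) * Real.exp (α * |x|) * Real.exp (Real.pi / 4 * |x|)) := by ring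
    _ = _ := by
      rw [← Real.exp_add, ← Real.exp_add, hδ]
      congr 2
      ring

lemma integrable_norm_mul_exp {f : ℂ → ℂ} (hf : ClassF1 f) :
    Integrable (fun x : ℝ => ‖f x‖ * Real.exp (Real.pi / 4 * |x|)) nu := by
  have hcont := hf.continuous_ofReal
  refine (integrable_weight hf).mono' (hcont.norm.mul (by fun_prop)).aestronglyMeasurable
    (Filter.Eventually.of_forall fun x => ?_)
  rw [Real.norm_of_nonneg (by positivity)]
  exact le_mul_of_one_le_left (by positivity) (by linarith [abs_nonneg x])

/-- The generating function of the coefficients `f_k`. -/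
lemma hasSum_coeff {f : ℂ → ℂ} (hf : ClassF1 f) {s : ℂ} (hs : ‖s‖ < 1) :
    HasSum (fun k => coeff f k * s ^ k) (∫ x : ℝ, f x * genFun x s ∂nu) := by
  -- The Cauchy estimate on radius ρ > |s| dominates the terms by a geometric series of ratio |s|/ρ.
  obtain ⟨ρ, h1, hρ1⟩ := exists_between hs
  have hρ : 0 < ρ := (norm_nonneg s).trans_lt h1
  obtain ⟨M, hM⟩ := exists_norm_mpPoly_le hρ hρ1
  have hcont := hf.continuous_ofReal
  have hW := integrable_norm_mul_exp hf
  have hb : ∀ (k : ℕ) (x : ℝ), ‖f x * mpPoly k x * s ^ k‖ ≤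
      M * (‖s‖ / ρ) ^ k * (‖f x‖ * Real.exp (Real.pi / 4 * |x|)) := fun k x => by
    rw [norm_mul, norm_mul, norm_pow]
    calc _ ≤ ‖f x‖ * (M * Real.exp (Real.pi / 4 * |x|) / ρ ^ k) * ‖s‖ ^ k := by
          gcongr
          exact hM k x
      _ = _ := by rw [div_pow]; ring
  have hint : ∀ k, Integrable (fun x : ℝ => f x * mpPoly k x * s ^ k) nu := fun k =>
    (hW.const_mul _).mono' ((hcont.mul (continuous_mpPoly k)).mul
      continuous_const).aestronglyMeasurable (Filter.Eventually.of_forall (hb k))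
  have key := hasSum_integral_of_summable_integral_norm hint (by
    refine Summable.of_nonneg_of_le (fun k => by positivity)
      (fun k => (integral_mono (hint k).norm (hW.const_mul _) (hb k)).trans_eq ?_)
      (((summable_geometric_of_lt_one (r := ‖s‖ / ρ) (by positivity)
        ((div_lt_one hρ).2 h1)).mul_left M).mul_right
        (∫ x : ℝ, ‖f x‖ * Real.exp (Real.pi / 4 * |x|) ∂nu))
    rw [integral_const_mul])
  simp only [mul_assoc, tsum_mul_left, (hasSum_mpPoly _ hs).tsum_eq] at key
  simp only [← mul_assoc, integral_mul_const] at key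
  exact key

/-- Termwise differentiation of a power series in the unit disc. -/
lemma exists_deriv_powerSeries {a : ℕ → ℂ} {F : ℂ → ℂ}
    (hF : ∀ s : ℂ, ‖s‖ < 1 → HasSum (fun k => a k * s ^ k) (F s)) :
    ∃ D : ℂ → ℂ, ContinuousOn D (Metric.ball 0 1) ∧ ∀ s : ℂ, ‖s‖ < 1 →
      HasSum (fun k : ℕ => ((k : ℂ) + 1) * a (k + 1) * s ^ k) (D s) ∧ HasDerivAt F (D s) s := by
  have key : ∀ s : ℂ, ‖s‖ < 1 →
      ∃ d, HasSum (fun k : ℕ => ((k : ℂ) + 1) * a (k + 1) * s ^ k) d ∧ HasDerivAt F d s := by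
    intro s hs
    obtain ⟨ρ, h1, hρ1⟩ := exists_between hs
    obtain ⟨R, h2, hR1⟩ := exists_between hρ1
    have hρ : 0 < ρ := (norm_nonneg s).trans_lt h1
    have hR : 0 < R := hρ.trans h2
    have hsumR := (hF R (by rwa [Complex.norm_real, Real.norm_of_nonneg hR.le])).summable
    obtain ⟨M, hM⟩ := hsumR.tendsto_atTop_zero.norm.bddAbove_range
    have hM' : ∀ k, ‖a k‖ * R ^ k ≤ M := fun k => by
      have := hM (mem_range_self k)
      simpa [abs_of_pos hR] using this
    -- This is k ρ^{k-1} · M/R^k, from |a_k| ≤ M/R^k and |y| ≤ ρ < R.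
    set u : ℕ → ℝ := fun k => M / ρ * ((k : ℝ) ^ 1 * (ρ / R) ^ k) with hu
    have hus : Summable u := by
      refine Summable.mul_left _ (summable_pow_mul_geometric_of_norm_lt_one 1 ?_)
      rw [Real.norm_of_nonneg (by positivity), div_lt_one hR]
      exact h2
    have hg : ∀ (k : ℕ) (y : ℂ), y ∈ Metric.ball (0 : ℂ) ρ →
        ‖a k * ((k : ℂ) * y ^ (k - 1))‖ ≤ u k := fun k y hy => by
      have hy' : ‖y‖ ≤ ρ := (mem_ball_zero_iff.1 hy).le
      rcases k with _ | k
      · simp [hu]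
      · have h3 := hM' (k + 1)
        have h4 : ‖a (k + 1)‖ ≤ M / R ^ (k + 1) := by rwa [le_div_iff₀ (by positivity)]
        rw [norm_mul, norm_mul, norm_pow, RCLike.norm_natCast, Nat.add_sub_cancel]
        have h5 : 0 ≤ M / R ^ (k + 1) := (norm_nonneg _).trans h4
        calc _ ≤ M / R ^ (k + 1) * (((k + 1 : ℕ) : ℝ) * ρ ^ k) := by gcongr
          _ = _ := by
            rw [hu]
            simp only [div_pow, pow_one]
            field_simp
            ring
    have hsb : s ∈ Metric.ball (0 : ℂ) ρ := mem_ball_zero_iff.2 h1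
    have hder := hasDerivAt_tsum_of_isPreconnected (g := fun k y => a k * y ^ k)
      (g' := fun k y => a k * ((k : ℂ) * y ^ (k - 1))) hus Metric.isOpen_ball
      (convex_ball (0 : ℂ) ρ).isPreconnected (fun k y _ => (hasDerivAt_pow k y).const_mul (a k))
      hg hsb (hF s hs).summable hsb
    have hsum : Summable fun k : ℕ => a k * ((k : ℂ) * s ^ (k - 1)) :=
      Summable.of_norm_bounded hus fun k => hg k s hsb
    refine ⟨_, ?_, hder.congr_of_eventuallyEq ?_⟩
    · rw [hsum.tsum_eq_zero_add]
      have h5 := ((summable_nat_add_iff 1).2 hsum).hasSum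
      simp only [Nat.cast_zero, zero_mul, mul_zero, zero_add]
      have e : ∀ k : ℕ, a (k + 1) * (((k + 1 : ℕ) : ℂ) * s ^ (k + 1 - 1)) =
          ((k : ℂ) + 1) * a (k + 1) * s ^ k := fun k => by
        rw [Nat.add_sub_cancel]; push_cast; ring
      simpa only [e] using h5
    · filter_upwards [Metric.isOpen_ball.mem_nhds hsb] with y hy
      exact (hF y ((mem_ball_zero_iff.1 hy).trans hρ1)).tsum_eq.symm
  choose! D hD using key
  refine ⟨D, ?_, hD⟩
  have hdiff : DifferentiableOn ℂ F (Metric.ball 0 1) := fun s hs =>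
    (hD s (mem_ball_zero_iff.1 hs)).2.differentiableAt.differentiableWithinAt
  refine (hdiff.deriv Metric.isOpen_ball).continuousOn.congr fun s hs => ?_
  exact (hD s (mem_ball_zero_iff.1 hs)).2.deriv.symm

lemma integrable_mul_exp {f : ℂ → ℂ} (hf : ClassF1 f) {θ : ℂ} (hθ : θ ∈ vstrip) :
    Integrable (fun x : ℝ => f x * Complex.exp (x * θ)) nu := by
  have hcont := hf.continuous_ofReal
  refine (integrable_norm_mul_exp hf).mono' (hcont.mul (by fun_prop)).aestronglyMeasurable
    (Filter.Eventually.of_forall fun x => ?_)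
  rw [norm_mul]
  gcongr
  exact norm_exp_real_mul_le (le_of_lt hθ) x

/-- Differentiation under the integral of the Laplace transform of `f` with respect to `ν`. -/
lemma hasDerivAt_laplace {f : ℂ → ℂ} (hf : ClassF1 f) {θ : ℂ} (hθ : θ ∈ vstrip) :
    Integrable (fun x : ℝ => f x * (Complex.exp (x * θ) * x)) nu ∧
    HasDerivAt (fun θ => ∫ x : ℝ, f x * Complex.exp (x * θ) ∂nu)
      (∫ x : ℝ, f x * (Complex.exp (x * θ) * x) ∂nu) θ := by
  have hcont := hf.continuous_ofReal
  refine hasDerivAt_integral_of_dominated_loc_of_deriv_le (isOpen_vstrip.mem_nhds hθ)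
    (F' := fun θ (x : ℝ) => f x * (Complex.exp (x * θ) * x))
    (Filter.Eventually.of_forall fun θ => (hcont.mul (by fun_prop)).aestronglyMeasurable)
    (integrable_mul_exp hf hθ) (hcont.mul (by fun_prop)).aestronglyMeasurable
    (Filter.Eventually.of_forall fun x η hη => ?_) (integrable_weight hf)
    (Filter.Eventually.of_forall fun x η hη => ?_)
  · rw [norm_mul, norm_mul, Complex.norm_real, Real.norm_eq_abs]
    have h1 := norm_exp_real_mul_le (le_of_lt (show |η.re| < _ from hη)) x
    calc _ ≤ ‖f x‖ * (Real.exp (Real.pi / 4 * |x|) * (1 + |x|)) := by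
          gcongr
          linarith
      _ = _ := by ring
  · have : HasDerivAt (fun η : ℂ => (x : ℂ) * η) x η := by
      simpa using (hasDerivAt_id η).const_mul (x : ℂ)
    exact this.cexp.const_mul (f x)

/-- The Fourier transform of `K_u Δ_f` is `4 i` times the derivative of `F (tan θ)`, where `F` is
the generating function of the coefficients. -/
lemma fourierHat_eq_deriv {f : ℂ → ℂ} (hf : ClassF1 f) {F D : ℂ → ℂ}
    (hF : ∀ s : ℂ, ‖s‖ < 1 → F s = ∫ x : ℝ, f x * genFun x s ∂nu)
    (hD : ∀ s : ℂ, ‖s‖ < 1 → HasDerivAt F (D s) s) {θ : ℂ} (hθ : θ ∈ vstrip) :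
    fourierHat (fun x => (Ker θ.re x : ℂ) * Del f x) θ.im =
      4 * Complex.I * (D (Complex.tan θ) * (1 / Complex.cos θ ^ 2)) := by
  have h1 : HasDerivAt (fun θ => F (Complex.tan θ))
      (D (Complex.tan θ) * (1 / Complex.cos θ ^ 2)) θ :=
    (hD _ (norm_tan_lt_one hθ)).comp θ (Complex.hasDerivAt_tan (cos_ne_zero hθ))
  obtain ⟨hi, hl⟩ := hasDerivAt_laplace hf hθ
  have h2 := hl.mul (Complex.hasDerivAt_cos θ)
  have h3 : (fun θ => F (Complex.tan θ)) =ᶠ[nhds θ]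
      fun θ => (∫ x : ℝ, f x * Complex.exp (x * θ) ∂nu) * Complex.cos θ := by
    filter_upwards [isOpen_vstrip.mem_nhds hθ] with η hη
    rw [hF _ (norm_tan_lt_one hη), ← integral_mul_const]
    simp only [genFun_tan hη, mul_assoc]
  -- The chain rule and the product rule compute the same derivative; the latter gives the integrand
  -- x cos θ - sin θ of `fourierHat_eq`.
  rw [h1.unique (h2.congr_of_eventuallyEq h3), fourierHat_eq hf (le_of_lt hθ),
    ← integral_mul_const, ← integral_mul_const, ← integral_add (hi.mul_const _)
    ((integrable_mul_exp hf hθ).mul_const _), integral_nu, ← integral_const_mul]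
  congr 1 with x
  ring

/-! ### The exact identity on the strip and the conclusion -/

/-- Integration over the vertical strip in Cartesian coordinates. -/
lemma lintegral_vstrip {g : ℂ → ENNReal} (hg : AEMeasurable g (volume.restrict vstrip)) :
    ∫⁻ z in vstrip, g z = ∫⁻ u in Ioo (-(Real.pi / 4)) (Real.pi / 4), ∫⁻ v : ℝ,
      g (u + v * Complex.I) := by
  have hmp := Complex.volume_preserving_equiv_real_prod.symm
  have hemb := Complex.measurableEquivRealProd.symm.measurableEmbedding
  have hpre : Complex.measurableEquivRealProd.symm ⁻¹' vstrip =
      Ioo (-(Real.pi / 4)) (Real.pi / 4) ×ˢ univ := by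
    ext p
    simp [vstrip, abs_lt]
  have hmp' := hmp.restrict_preimage isOpen_vstrip.measurableSet
  have hg' := (hmp'.aemeasurable_comp_iff hemb).2 hg
  rw [← hmp.setLIntegral_comp_preimage_emb hemb]
  rw [hpre, Measure.volume_eq_prod, ← Measure.prod_restrict] at hg' ⊢
  refine (lintegral_prod _ hg').trans ?_
  simp [Complex.mk_eq_add_mul_I]

/-- The weighted coefficient sum as an integral over the strip. -/
lemma tsum_Gam_eq_lintegral {f : ℂ → ℂ} (hf : ClassF1 f) {φ : ℝ → ℝ}
    (hφ : AEMeasurable φ (volume.restrict (Ioo (0 : ℝ) 1))) :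
    ∑' k : ℕ, Gam φ (k + 1) * ‖coeff f (k + 1)‖ₑ ^ 2 =
      ENNReal.ofReal (1 / (8 * Real.pi)) *
        ∫⁻ u in Ioo (-(Real.pi / 4)) (Real.pi / 4), ∫⁻ v : ℝ,
          ‖fourierHat (fun x => (Ker u x : ℂ) * Del f x) v‖ₑ ^ 2 *
            Phi φ (1 - ‖Complex.tan (u + v * Complex.I)‖) := by
  obtain ⟨D, hDc, hD⟩ := exists_deriv_powerSeries fun s hs => hasSum_coeff hf hs
  have hpi := Real.pi_pos
  -- The chain-rule factor 1/cos² is also the one in the Jacobian of s = tan θ, so the change of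
  -- variables leaves only |4i|² = 16.
  have hfh : ∀ z ∈ vstrip, ‖fourierHat (fun x => (Ker z.re x : ℂ) * Del f x) z.im‖ₑ ^ 2 =
      16 * (‖1 / Complex.cos z ^ 2‖ₑ ^ 2 * ‖D (Complex.tan z)‖ₑ ^ 2) := fun z hz => by
    rw [fourierHat_eq_deriv hf (fun s _ => rfl) (fun s hs => (hD s hs).2) hz, enorm_mul, mul_pow,
      enorm_mul (D _), mul_pow (‖D _‖ₑ), mul_comm (‖D (Complex.tan z)‖ₑ ^ 2)]
    congr 1
    rw [← ofReal_norm, norm_mul, Complex.norm_I, ← ENNReal.ofReal_pow (by positivity)]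
    norm_num
  have htan : ContinuousOn Complex.tan vstrip := fun z hz =>
    (Complex.hasDerivAt_tan (cos_ne_zero hz)).continuousAt.continuousWithinAt
  have htanm : AEMeasurable Complex.tan (volume.restrict vstrip) :=
    htan.aemeasurable isOpen_vstrip.measurableSet
  have hDm : AEMeasurable (fun z => D (Complex.tan z)) (volume.restrict vstrip) :=
    (hDc.comp htan fun z hz => mem_ball_zero_iff.2 (norm_tan_lt_one hz)).aemeasurable
      isOpen_vstrip.measurableSet
  have hfm : AEMeasurable (fun z : ℂ =>
      ‖fourierHat (fun x => (Ker z.re x : ℂ) * Del f x) z.im‖ₑ ^ 2) (volume.restrict vstrip) := by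
    -- Joint measurability of the transform in (u, v) is read off from its expression through D and
    -- tan.
    refine AEMeasurable.congr (f := fun z =>
      16 * (‖1 / Complex.cos z ^ 2‖ₑ ^ 2 * ‖D (Complex.tan z)‖ₑ ^ 2)) ?_
      ((ae_restrict_mem isOpen_vstrip.measurableSet).mono fun z hz => (hfh z hz).symm)
    exact ((by fun_prop : Measurable fun z : ℂ => ‖1 / Complex.cos z ^ 2‖ₑ ^ 2).aemeasurable.mul
      (hDm.enorm.pow_const 2)).const_mul 16
  rw [tsum_Gam_mul_sq hφ (fun s hs => (hD s hs).1) hDc, lintegral_ball_eq_lintegral_vstrip]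
  have h16 : ENNReal.ofReal (2 / Real.pi) = ENNReal.ofReal (1 / (8 * Real.pi)) * 16 := by
    rw [show (16 : ENNReal) = ENNReal.ofReal 16 by simp, ← ENNReal.ofReal_mul (by positivity)]
    congr 1
    field_simp
    norm_num
  rw [h16, mul_assoc, ← lintegral_const_mul' _ _ (by simp)]
  congr 1
  have e : ∫⁻ z in vstrip, 16 * (‖1 / Complex.cos z ^ 2‖ₑ ^ 2 *
      (‖D (Complex.tan z)‖ₑ ^ 2 * Phi φ (1 - ‖Complex.tan z‖))) =
      ∫⁻ z in vstrip, ‖fourierHat (fun x => (Ker z.re x : ℂ) * Del f x) z.im‖ₑ ^ 2 *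
        Phi φ (1 - ‖Complex.tan z‖) :=
    setLIntegral_congr_fun isOpen_vstrip.measurableSet fun z hz => by
      rw [hfh z hz]; ring
  rw [e, lintegral_vstrip]
  · simp
  · exact hfm.mul ((monotone_Phi φ).measurable.comp_aemeasurable
      (htanm.norm.const_sub 1))

end MeixnerPollaczek

theorem mainTheorem4 (f : ℂ → ℂ) (hf : MeixnerPollaczek.ClassF1 f)
    (φ : ℝ → ℝ) (hφ_meas : AEMeasurable φ (volume.restrict (Ioo (0 : ℝ) 1)))
    (hφ_nonneg : ∀ ε ∈ Ioo (0 : ℝ) 1, 0 ≤ φ ε) :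
    (∀ u : ℝ, |u| ≤ Real.pi / 4 →
      Integrable (fun x : ℝ => (MeixnerPollaczek.Ker u x : ℂ) * MeixnerPollaczek.Del f x)) ∧
    (∑' k : ℕ, MeixnerPollaczek.Gam φ (k + 1) * ‖MeixnerPollaczek.coeff f (k + 1)‖ₑ ^ 2)
      ≤ MeixnerPollaczek.energy φ f 1 ∧
    MeixnerPollaczek.energy φ f (1 / (2 * Real.pi))
      ≤ ∑' k : ℕ, MeixnerPollaczek.Gam φ (k + 1) * ‖MeixnerPollaczek.coeff f (k + 1)‖ₑ ^ 2 := by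
  have hmem : ∀ u ∈ Ioo (-(Real.pi / 4)) (Real.pi / 4), ∀ v : ℝ,
      (u + v * Complex.I : ℂ) ∈ MeixnerPollaczek.vstrip := fun u hu v => by
    simpa [MeixnerPollaczek.vstrip] using abs_lt.2 hu
  refine ⟨fun u hu => MeixnerPollaczek.integrable_Ker_mul_Del hf hu, ?_, ?_⟩
  -- The identity lives on the open strip, and the endpoints u = ±π/4 are null; only the arguments
  -- of Φ remain to be compared.
  · rw [MeixnerPollaczek.tsum_Gam_eq_lintegral hf hφ_meas, MeixnerPollaczek.energy,
      ← setLIntegral_congr Ioo_ae_eq_Icc]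
    refine mul_le_mul_right (setLIntegral_mono' measurableSet_Ioo fun u hu =>
      lintegral_mono fun v => mul_le_mul_right (MeixnerPollaczek.monotone_Phi φ ?_) _) _
    simpa using MeixnerPollaczek.one_sub_norm_tan_le (hmem u hu v)
  · rw [MeixnerPollaczek.tsum_Gam_eq_lintegral hf hφ_meas, MeixnerPollaczek.energy,
      ← setLIntegral_congr Ioo_ae_eq_Icc]
    refine mul_le_mul_right (setLIntegral_mono' measurableSet_Ioo fun u hu =>
      lintegral_mono fun v => mul_le_mul_right (MeixnerPollaczek.monotone_Phi φ ?_) _) _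
    simpa using MeixnerPollaczek.le_one_sub_norm_tan (hmem u hu v)
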